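/- **Conventions.** For an open set $I\subseteq\mathbb{R}$, $\mathcal{D}'(I)$ is the space of (complex-valued) Schwartz distributions on $I$. Fourier transforms are normalized by $\widehat{f}(t)=\int_{-\infty}^{\infty}e^{-itx}f(x)\,dx$ and taken in the sense of tempered distributions when the integral does not make sense. Let $A(\mathbb{R})=\{\widehat f: f\in L^1(\mathbb{R})\}$ (an algebra of continuous functions), $PM(\mathbb{R})=\{\widehat f: f\in L^\infty(\mathbb{R})\}$, and $PF(\mathbb{R})=\{\widehat f: f\in L^\infty(\mathbb{R}),\ \operatorname{ess\,lim}_{|x|\to\infty}f(x)=0\}$. For $X=A,PM,PF$, write $g\in X_{loc}(t_0)$ if $g$ coincides with an element of $X(\mathbb{R})$ on a neighborhood of $t_0$; elements of $A_{loc}(t_0)$ are thus continuous functions near $t_0$. The product of $\widehat{f}_1\in A(\mathbb{R})$ and $\widehat{f}_2\in PM(\mathbb{R})$ is $\widehat{f}_1\cdot\widehat{f}_2=\widehat{f_1\ast f_2}$; correspondingly, for $g_1\in A_{loc}(t_0)$ and $g_2\in PM_{loc}(t_0)$ the product $g_1\cdot g_2$ is defined near $t_0$ by taking global elements that coincide with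 $g_1$ and $g_2$ near $t_0$. A real-valued function $S$ on $[0,\infty)$ is *strongly log-linearly slowly decreasing* if there are a non-increasing positive function $\eta$ with $\eta(x)\to0$ as $x\to\infty$ and constants $\delta,x_0>0$ such that $$\frac{S(y)-S(x)}{e^{x}}\ge-\eta(x)\qquad\text{for } x\le y\le x+\delta \text{ and } x\ge x_0 .$$ **Theorem 3.1.** Let $S\in L^1_{loc}[0,\infty)$ be real-valued and strongly log-linearly slowly decreasing. Suppose that the Laplace transform $\mathcal{L}\{S;s\}=\int_0^\infty e^{-sx}S(x)\,dx$ converges (as an improper integral) for $\operatorname{Re}s>1$, and that for some $a>0$ the function $$G(s)=\mathcal{L}\{S;s\}-\frac{a}{s-1},\qquad \operatorname{Re}s>1,$$ has a distributional boundary value $g\in\mathcal{D}'(I)$ on $1+iI$, where $I$ is a bounded open interval containing $0$; that is, $$\lim_{\sigma\to1^+}\int_{-\infty}^{\infty}G(\sigma+it)\varphi(t)\,dt=\langle g,\varphi\rangle\qquad\text{for every smooth }\varphi\text{ with compact support in } I.$$ Suppose that near $0$ one can write $g=g_1\cdot g_2+g_3$, where $g_1\in A_{loc}(0)$ and $g_1(0)=0$,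 $g_2\in PM_{loc}(0)$, and $g_3\in PF_{loc}(0)$. Then $$e^x\ll S(x)\ll e^x,\qquad x\to\infty,$$ that is, $S$ is eventually positive, and $e^x=O(S(x))$ and $S(x)=O(e^x)$ as $x\to\infty$. (Equivalently, there are $c,C>0$ with $c\,e^x\le S(x)\le C e^x$ for all sufficiently large $x$.) -/

import Mathlib

open Filter Topology MeasureTheory
open scoped Distributions SchwartzMap

noncomputable section

namespace WienerIkehara

/-! ### The Tauberian condition -/

/-- `S`, regarded as a real function on `[0, ∞)`, is strongly log-linearly slowly decreasing:
there are a positive non-increasing function `η` on `[0, ∞)` with `η(x) → 0` as `x → ∞` and constants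
`δ, x₀ > 0` such that `(S(y) - S(x)) / e^x ≥ -η(x)` for `x ≤ y ≤ x + δ` and `x ≥ x₀`. -/
def StronglyLogLinearlySlowlyDecreasing (S : ℝ → ℝ) : Prop :=
  ∃ η : ℝ → ℝ, (∀ x, 0 ≤ x → 0 < η x) ∧ AntitoneOn η (Set.Ici 0) ∧ Tendsto η atTop (𝓝 0) ∧
    ∃ δ > 0, ∃ x₀ > 0, ∀ x y : ℝ, x₀ ≤ x → x ≤ y → y ≤ x + δ →
      -η x ≤ (S y - S x) / Real.exp x

/-! ### The Laplace transform -/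

/-- The truncated Laplace integral `∫_0^R e^{-s x} S(x) dx`. -/
def laplacePartial (S : ℝ → ℝ) (s : ℂ) (R : ℝ) : ℂ :=
  ∫ x in (0 : ℝ)..R, Complex.exp (-s * x) * (S x : ℂ)

/-- The Laplace integral of `S` converges at `s`, as an improper integral. -/
def LaplaceConvergesAt (S : ℝ → ℝ) (s : ℂ) : Prop :=
  ∃ l : ℂ, Tendsto (laplacePartial S s) atTop (𝓝 l)

/-- The Laplace transform `𝓛{S; s} = lim_{R → ∞} ∫_0^R e^{-s x} S(x) dx`
(meaningful where the Laplace integral converges). -/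
def laplace (S : ℝ → ℝ) (s : ℂ) : ℂ :=
  limUnder atTop (laplacePartial S s)

/-! ### Fourier transforms and the global spaces `A(ℝ)`, `PM(ℝ)`, `PF(ℝ)` -/

/-- The Fourier integral `t ↦ ∫ e^{-i t x} f(x) dx`. -/
def fourierIntegral (f : ℝ → ℂ) (t : ℝ) : ℂ :=
  ∫ x : ℝ, Complex.exp (-Complex.I * t * x) * f x

/-- The tempered distribution `T` is the Fourier transform of the (bounded measurable) function
`f`: `⟨T, φ⟩ = ∫ f(x) φ̂(x) dx` for every Schwartz function `φ`. -/
def IsFourierTransform (f : ℝ → ℂ) (T : 𝓢'(ℝ, ℂ)) : Prop :=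
  ∀ φ : 𝓢(ℝ, ℂ), T φ = ∫ x : ℝ, f x * fourierIntegral φ x

/-- The Wiener algebra `A(ℝ)`: Fourier transforms of functions in `L¹(ℝ)`. -/
def wienerAlgebra : Set (ℝ → ℂ) :=
  {u | ∃ f : ℝ → ℂ, Integrable f ∧ u = fourierIntegral f}

/-- The global pseudomeasures `PM(ℝ)`: Fourier transforms of functions in `L^∞(ℝ)`. -/
def pseudomeasures : Set 𝓢'(ℝ, ℂ) :=
  {T | ∃ f : ℝ → ℂ, MemLp f ⊤ ∧ IsFourierTransform f T}

/-- The global pseudofunctions `PF(ℝ)`: Fourier transforms of functions in `L^∞(ℝ)` with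
essential limit `0` at `±∞`. -/
def pseudofunctions : Set 𝓢'(ℝ, ℂ) :=
  {T | ∃ f : ℝ → ℂ, MemLp f ⊤ ∧ Tendsto f (cocompact ℝ ⊓ ae volume) (𝓝 0) ∧
    IsFourierTransform f T}

/-- `P` is the product `u · T` of `u ∈ A(ℝ)` and `T ∈ PM(ℝ)`, i.e. `P` is the Fourier transform of
the convolution `f₁ ∗ f₂`, where `f₁ ∈ L¹(ℝ)` and `f₂ ∈ L^∞(ℝ)` have Fourier transforms
`u` and `T`. -/
def IsModuleProduct (u : ℝ → ℂ) (T P : 𝓢'(ℝ, ℂ)) : Prop :=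
  ∃ f₁ f₂ : ℝ → ℂ, Integrable f₁ ∧ MemLp f₂ ⊤ ∧
    u = fourierIntegral f₁ ∧ IsFourierTransform f₂ T ∧
    IsFourierTransform (fun x => ∫ y : ℝ, f₁ y * f₂ (x - y)) P

/-! ### The local spaces

Distributions on an open set `I ⊆ ℝ` are the elements of Mathlib's `𝓓'(I, ℂ)`: complex-valued,
continuous, and tested against real test functions, which determines their complex-linear extension
to complex test functions. -/

variable {I : TopologicalSpace.Opens ℝ}

/-- A test function on `I`, viewed as a complex-valued Schwartz function on `ℝ`. -/
def toSchwartz (φ : 𝓓(I, ℝ)) : 𝓢(ℝ, ℂ) :=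
  HasCompactSupport.toSchwartzMap (f := fun t => ((φ t : ℝ) : ℂ))
    (φ.hasCompactSupport.comp_left Complex.ofReal_zero)
    (Complex.ofRealCLM.contDiff.comp φ.contDiff)

/-- The distribution `g` on `I` and the tempered distribution `T` coincide on `U`. -/
def CoincideOn (g : 𝓓'(I, ℂ)) (T : 𝓢'(ℝ, ℂ)) (U : Set ℝ) : Prop :=
  ∀ φ : 𝓓(I, ℝ), tsupport φ ⊆ U → g φ = T (toSchwartz φ)

/-- `g ∈ A_loc(t₀)`: near `t₀` the function `g` coincides with an element of `A(ℝ)`. Elements of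
`A_loc(t₀)` are continuous functions near `t₀`, so they are given as functions and have a
value at `t₀`. -/
def MemWienerLoc (g : ℝ → ℂ) (t₀ : ℝ) : Prop :=
  ∃ u ∈ wienerAlgebra, g =ᶠ[𝓝 t₀] u

/-- `g ∈ PM_loc(t₀)`: on a neighborhood of `t₀` in `I`, the distribution `g` coincides with a global
pseudomeasure. -/
def MemPMLoc (g : 𝓓'(I, ℂ)) (t₀ : ℝ) : Prop :=
  ∃ U : Set ℝ, IsOpen U ∧ t₀ ∈ U ∧ U ⊆ I ∧ ∃ T ∈ pseudomeasures, CoincideOn g T U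

/-- `g ∈ PF_loc(t₀)`: on a neighborhood of `t₀` in `I`, the distribution `g` coincides with a global
pseudofunction. -/
def MemPFLoc (g : 𝓓'(I, ℂ)) (t₀ : ℝ) : Prop :=
  ∃ U : Set ℝ, IsOpen U ∧ t₀ ∈ U ∧ U ⊆ I ∧ ∃ T ∈ pseudofunctions, CoincideOn g T U

/-- `p = g₁ · g₂` near `t₀`, for `g₁ ∈ A_loc(t₀)` and `g₂ ∈ PM_loc(t₀)`: on a neighborhood
of `t₀` in `I`, the objects `g₁`, `g₂`, `p` coincide with `u ∈ A(ℝ)`, `T ∈ PM(ℝ)` and the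
product `u · T`, respectively. -/
def IsProductNear (t₀ : ℝ) (g₁ : ℝ → ℂ) (g₂ p : 𝓓'(I, ℂ)) : Prop :=
  ∃ U : Set ℝ, IsOpen U ∧ t₀ ∈ U ∧ U ⊆ I ∧
    ∃ (u : ℝ → ℂ) (T P : 𝓢'(ℝ, ℂ)), IsModuleProduct u T P ∧
      Set.EqOn g₁ u U ∧ CoincideOn g₂ T U ∧ CoincideOn p P U

/-- `g` is the distributional boundary value of `G` (a function on `Re s > 1`) on `1 + iI`. -/
def IsBoundaryValue (G : ℂ → ℂ) (g : 𝓓'(I, ℂ)) : Prop :=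
  ∀ φ : 𝓓(I, ℝ),
    Tendsto (fun σ : ℝ => ∫ t : ℝ, G (σ + t * Complex.I) * ((φ t : ℝ) : ℂ)) (𝓝[>] 1) (𝓝 (g φ))

end WienerIkehara

end

/-! Put `D x = S x * exp (-x)`. Since `a/(s-1)` is the Laplace transform of `a * exp x`, the
boundary value `g` is formally the Fourier transform of `D - a` on the half-line. The proof shows
that averages of `D` against a suitable positive kernel centred far out stay within `a/2` of `a`,
relative to the mass of the kernel, and then passes from averages to pointwise bounds by slow
decrease.

Averages. Let `K ≥ 0` be even with compactly supported Fourier transform. Pairing `g` with `2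
cos(ht) φ(Lt)`, where `φ` has transform `K`, tests `D - a` against `W_h`, the sum of the translates
by `±h` of `x ↦ K(x/L)/L`. One-sided boundedness of `D` legitimizes the limit `σ → 1⁺`
(`integrableOn_and_setIntegral_eq_of_tendsto_abel`). The pseudofunction part of `g` contributes
`o(1)` as `h → ∞`. In the part `g₁ · g₂`, with transforms of `f₁ ∈ L¹` and `f₂ ∈ L^∞`, the condition
`g₁ 0 = 0` says that `f₁` has mean zero. Hence the pairing of `f₁ ∗ f₂` with `W_h` only sees
differences `W_h(x+y) - W_h(x)`; it need not tend to zero as `h → ∞`, but it is small uniformly in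
`h` once `L` is large, because `K(·/L)/L` is nearly translation invariant in `L¹`. See
`exists_kernel_average_near`.

Pointwise bounds. Iterated slow decrease gives `D y ≥ exp (x-y) * D x - η x` for `y ≥ x`. A huge
value of `D` forces large values just after it, hence a large average; so `D` is bounded above. A
tiny value of `D` forces small values on a long interval just before it; with the upper bound
controlling the rest of the kernel, the average there would be too small. Only this last step needs
`η → 0`. -/

namespace WienerIkehara

open scoped ContDiff Convolution

/-! ### Positive kernels with compactly supported Fourier transform -/

/-- A nonnegative even continuous function with quadratic decay that is positive at the origin. -/
structure IsTauberianKernel (K : ℝ → ℝ) : Prop where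
  continuous : Continuous K
  nonneg : ∀ x, 0 ≤ K x
  even : ∀ x, K (-x) = K x
  pos_zero : 0 < K 0
  decay : ∃ C, ∀ x, K x ≤ C / (1 + x ^ 2)

theorem fourierIntegral_eq_fourier (f : ℝ → ℂ) (x : ℝ) :
    fourierIntegral f x = FourierTransform.fourier f (x / (2 * Real.pi)) := by
  rw [Real.fourier_eq']
  unfold fourierIntegral
  congr 1 with t
  rw [smul_eq_mul]
  congr 2
  have : (Real.pi : ℂ) ≠ 0 := by exact_mod_cast Real.pi_ne_zero
  simp
  field_simp

theorem continuous_fourierIntegral_schwartz (f : 𝓢(ℝ, ℂ)) : Continuous (fourierIntegral f) := by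
  have : fourierIntegral f = fun x => (FourierTransform.fourier f) (x / (2 * Real.pi)) := by
    ext x
    rw [fourierIntegral_eq_fourier, SchwartzMap.fourier_coe]
  rw [this]
  exact (FourierTransform.fourier f).continuous.comp (by fun_prop)

/-- First-order decay suffices: the kernel is the square of such a transform. -/
theorem exists_norm_fourierIntegral_schwartz_le (f : 𝓢(ℝ, ℂ)) :
    ∃ C, ∀ x, ‖fourierIntegral f x‖ ≤ C / (1 + |x|) := by
  set F := FourierTransform.fourier f with hF
  obtain ⟨C₀, -, h₀⟩ := F.decay 0 0
  obtain ⟨C₁, -, h₁⟩ := F.decay 1 0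
  refine ⟨C₀ + C₁ * (2 * Real.pi), fun x => ?_⟩
  rw [fourierIntegral_eq_fourier, ← SchwartzMap.fourier_coe, ← hF, le_div_iff₀ (by positivity)]
  have a₀ := h₀ (x / (2 * Real.pi))
  have a₁ := h₁ (x / (2 * Real.pi))
  simp only [pow_zero, one_mul, norm_iteratedFDeriv_zero, pow_one, Real.norm_eq_abs, abs_div,
    abs_of_pos Real.two_pi_pos] at a₀ a₁
  have hp := Real.two_pi_pos
  rw [div_mul_eq_mul_div, div_le_iff₀ hp] at a₁
  linarith

theorem fourierIntegral_of_even {ψ : ℝ → ℝ} (hψ : Continuous ψ) (hc : HasCompactSupport ψ)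
    (he : ∀ t, ψ (-t) = ψ t) (x : ℝ) :
    fourierIntegral (fun t => (ψ t : ℂ)) x = ((∫ t : ℝ, Real.cos (x * t) * ψ t : ℝ) : ℂ) := by
  have hi1 : Integrable fun t : ℝ => Real.cos (x * t) * ψ t :=
    (by fun_prop : Continuous fun t : ℝ => Real.cos (x * t) * ψ t).integrable_of_hasCompactSupport
      hc.mul_left
  have hi2 : Integrable fun t : ℝ => Real.sin (x * t) * ψ t :=
    (by fun_prop : Continuous fun t : ℝ => Real.sin (x * t) * ψ t).integrable_of_hasCompactSupport
      hc.mul_left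
  have hodd : ∫ t : ℝ, Real.sin (x * t) * ψ t = 0 := by
    have := integral_neg_eq_self (fun t : ℝ => Real.sin (x * t) * ψ t) volume
    simp only [he, mul_neg, Real.sin_neg, neg_mul, integral_neg] at this
    linarith
  calc fourierIntegral (fun t => (ψ t : ℂ)) x
      = ∫ t : ℝ, (((Real.cos (x * t) * ψ t : ℝ) : ℂ)
          - Complex.I * ((Real.sin (x * t) * ψ t : ℝ) : ℂ)) := by
        unfold fourierIntegral
        congr 1 with t
        have : -Complex.I * x * t = ((-(x * t) : ℝ) : ℂ) * Complex.I := by push_cast; ring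
        rw [this, Complex.exp_mul_I, ← Complex.ofReal_cos, ← Complex.ofReal_sin, Real.cos_neg,
          Real.sin_neg]
        push_cast
        ring
    _ = _ := by
        rw [integral_sub hi1.ofReal (hi2.ofReal.const_mul _), integral_const_mul,
          integral_complex_ofReal, integral_complex_ofReal, hodd]
        simp

theorem fourierIntegral_convolution {f g : ℝ → ℝ} (hf : Integrable f) (hg : Integrable g) (x : ℝ) :
    fourierIntegral (fun t => ((f ⋆[ContinuousLinearMap.mul ℝ ℝ, volume] g) t : ℂ)) x
      = fourierIntegral (fun t => (f t : ℂ)) x * fourierIntegral (fun t => (g t : ℂ)) x := by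
  have hexp : ∀ {f : ℝ → ℝ}, Integrable f →
      Integrable fun t : ℝ => Complex.exp (-Complex.I * x * t) * (f t : ℂ) := by
    intro f hf
    refine hf.ofReal.bdd_mul (c := 1) (by fun_prop) (ae_of_all _ fun t => ?_)
    rw [Complex.norm_exp]
    simp
  have := integral_convolution (ContinuousLinearMap.mul ℝ ℂ) (μ := volume) (ν := volume)
    (hexp hf) (hexp hg)
  simp only [ContinuousLinearMap.mul_apply'] at this
  unfold fourierIntegral
  rw [← this]
  congr 1 with t
  simp only [convolution_def, ContinuousLinearMap.mul_apply']
  rw [← integral_complex_ofReal, ← integral_const_mul]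
  congr 1 with s
  have : Complex.exp (-Complex.I * x * t)
      = Complex.exp (-Complex.I * x * s) * Complex.exp (-Complex.I * x * ((t - s : ℝ) : ℂ)) := by
    rw [← Complex.exp_add]; push_cast; ring_nf
  rw [this]
  push_cast
  ring

/-- There is a test function whose Fourier transform is a positive kernel. -/
theorem exists_isTauberianKernel : ∃ φ K : ℝ → ℝ, ContDiff ℝ ∞ φ ∧ HasCompactSupport φ ∧
    (∀ t, 1 ≤ |t| → φ t = 0) ∧ IsTauberianKernel K ∧
    ∀ x, fourierIntegral (fun t => (φ t : ℂ)) x = K x := by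
  -- Outer radius `1/2` puts the support of `ψ ∗ ψ` inside `(-1, 1)`.
  let ψ : ContDiffBump (0 : ℝ) := ⟨1 / 4, 1 / 2, by norm_num, by norm_num⟩
  have hψc : Continuous ψ := ψ.continuous
  have hψs : HasCompactSupport ψ := ψ.hasCompactSupport
  have hψi : Integrable ψ := hψc.integrable_of_hasCompactSupport hψs
  have hψd : ContDiff ℝ ∞ ψ := ψ.contDiff
  let c : ℝ → ℝ := fun x => ∫ t : ℝ, Real.cos (x * t) * ψ t
  have hFc : ∀ x, fourierIntegral (fun t => (ψ t : ℂ)) x = c x :=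
    fourierIntegral_of_even hψc hψs (fun t => ψ.neg t)
  let f : 𝓢(ℝ, ℂ) := HasCompactSupport.toSchwartzMap (f := fun t => ((ψ t : ℝ) : ℂ))
    (hψs.comp_left Complex.ofReal_zero) (Complex.ofRealCLM.contDiff.comp hψd)
  have hf : ∀ x, fourierIntegral f x = c x := hFc
  have hcc : Continuous c := by
    have := Complex.continuous_re.comp (continuous_fourierIntegral_schwartz f)
    convert this using 1
    ext x
    simp [hf]
  obtain ⟨C, hC⟩ := exists_norm_fourierIntegral_schwartz_le f
  -- The transform `c` of the even bump is real, so that of `ψ ∗ ψ` is `c ^ 2`: nonnegative, with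
  -- quadratic decay.
  refine ⟨ψ ⋆[ContinuousLinearMap.mul ℝ ℝ, volume] ψ, fun x => c x ^ 2,
    hψs.contDiff_convolution_right (n := ⊤) _ hψi.locallyIntegrable hψd, hψs.convolution _ hψs, ?_,
    ⟨by fun_prop, fun x => sq_nonneg _, fun x => ?_, ?_, C ^ 2, fun x => ?_⟩, fun x => ?_⟩
  · intro t ht
    by_contra h
    have := support_convolution_subset (ContinuousLinearMap.mul ℝ ℝ) (Function.mem_support.2 h)
    obtain ⟨u, hu, v, hv, rfl⟩ := this
    rw [ψ.support_eq, Metric.mem_ball, dist_zero_right, Real.norm_eq_abs] at hu hv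
    have := abs_add_le u v
    simp only [ψ] at hu hv
    linarith
  · simp [c]
  · have : 0 < c 0 := by
      simp only [c, zero_mul, Real.cos_zero, one_mul]
      exact ψ.integral_pos
    positivity
  · have h1 := hC x
    rw [hf, Complex.norm_real, Real.norm_eq_abs, le_div_iff₀ (by positivity)] at h1
    rw [le_div_iff₀ (by positivity)]
    have h2 : (|c x| * (1 + |x|)) ^ 2 ≤ C ^ 2 := pow_le_pow_left₀ (by positivity) h1 2
    refine le_trans ?_ h2
    rw [mul_pow, sq_abs]
    refine mul_le_mul_of_nonneg_left ?_ (sq_nonneg _)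
    nlinarith [abs_nonneg x, sq_abs x]
  · rw [fourierIntegral_convolution hψi hψi, hFc]
    push_cast
    ring

namespace IsTauberianKernel

variable {K : ℝ → ℝ}

theorem bounded (hK : IsTauberianKernel K) : ∃ C, ∀ x, K x ≤ C := by
  obtain ⟨C, hC⟩ := hK.decay
  have hC0 : 0 ≤ C := by simpa using (hK.nonneg 0).trans (hC 0)
  exact ⟨C, fun x => (hC x).trans (div_le_self hC0 (by nlinarith [sq_nonneg x]))⟩

theorem integrable (hK : IsTauberianKernel K) : Integrable K := by
  obtain ⟨C, hC⟩ := hK.decay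
  refine (integrable_inv_one_add_sq.const_mul C).mono' hK.continuous.aestronglyMeasurable
    (ae_of_all _ fun x => ?_)
  rw [Real.norm_of_nonneg (hK.nonneg x), ← div_eq_mul_inv]
  exact hC x

theorem integral_pos (hK : IsTauberianKernel K) : 0 < ∫ x, K x :=
  integral_pos_of_integrable_nonneg_nonzero hK.continuous hK.integrable hK.nonneg hK.pos_zero.ne'

theorem intervalIntegral_pos (hK : IsTauberianKernel K) : 0 < ∫ x in (0 : ℝ)..1, K x :=
  intervalIntegral.integral_pos zero_lt_one hK.continuous.continuousOn (fun x _ => hK.nonneg x)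
    ⟨0, by simp, hK.pos_zero⟩

theorem eventually_lt (hK : IsTauberianKernel K) {ε : ℝ} (hε : 0 < ε) :
    ∃ N > 0, ∀ x, N ≤ |x| → K x < ε := by
  obtain ⟨C, hC⟩ := hK.decay
  have hC0 : 0 ≤ C := by simpa using (hK.nonneg 0).trans (hC 0)
  refine ⟨C / ε + 1, by positivity, fun x hx => (hC x).trans_lt ?_⟩
  rw [div_lt_iff₀ (by positivity)]
  have h1 : C / ε + 1 ≤ 1 + x ^ 2 := by
    rw [← sq_abs]
    have : 0 ≤ C / ε := by positivity
    nlinarith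
  have h2 : ε * (C / ε) = C := by field_simp
  nlinarith

/-- Flattening the kernel corresponds to shrinking the support of its test function, which `L → ∞`
exploits. -/
theorem rescale (hK : IsTauberianKernel K) {L : ℝ} (hL : 1 ≤ L) :
    IsTauberianKernel fun x => L⁻¹ * K (x / L) := by
  have hL0 : 0 < L := by linarith
  obtain ⟨C, hC⟩ := hK.decay
  have hC0 : 0 ≤ C := by simpa using (hK.nonneg 0).trans (hC 0)
  refine ⟨?_, fun x => mul_nonneg (by positivity) (hK.nonneg _), fun x => ?_, ?_, L * C,
    fun x => ?_⟩
  · have := hK.continuous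
    fun_prop
  · rw [neg_div, hK.even]
  · rw [zero_div]
    have := hK.pos_zero
    positivity
  · calc L⁻¹ * K (x / L) ≤ L⁻¹ * (C / (1 + (x / L) ^ 2)) := by gcongr; exact hC _
      _ = L * C / (L ^ 2 + x ^ 2) := by field_simp
      _ ≤ L * C / (1 + x ^ 2) := by gcongr; nlinarith

theorem integral_rescale (K : ℝ → ℝ) {L : ℝ} (hL : 1 ≤ L) :
    ∫ x, L⁻¹ * K (x / L) = ∫ x, K x := by
  rw [integral_const_mul, Measure.integral_comp_div, abs_of_pos (by linarith), smul_eq_mul,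
    inv_mul_cancel_left₀ (by linarith)]

end IsTauberianKernel

/-! ### Symmetrized translates -/

/-- The sum of the translates of `K` by `h` and `-h`. -/
def symmTranslate (K : ℝ → ℝ) (h x : ℝ) : ℝ := K (x - h) + K (x + h)

namespace IsTauberianKernel

variable {K : ℝ → ℝ}

theorem symmTranslate_continuous (hK : IsTauberianKernel K) (h : ℝ) :
    Continuous (symmTranslate K h) := by
  have := hK.continuous
  unfold symmTranslate
  fun_prop

theorem symmTranslate_nonneg (hK : IsTauberianKernel K) (h x : ℝ) : 0 ≤ symmTranslate K h x :=
  add_nonneg (hK.nonneg _) (hK.nonneg _)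

theorem symmTranslate_integrable (hK : IsTauberianKernel K) (h : ℝ) :
    Integrable (symmTranslate K h) :=
  (hK.integrable.comp_sub_right h).add (hK.integrable.comp_add_right h)

theorem symmTranslate_neg (hK : IsTauberianKernel K) (h x : ℝ) :
    symmTranslate K h (-x) = symmTranslate K h x := by
  unfold symmTranslate
  rw [← hK.even (-x - h), ← hK.even (-x + h), add_comm]
  ring_nf

theorem integral_symmTranslate (hK : IsTauberianKernel K) (h : ℝ) :
    ∫ x, symmTranslate K h x = 2 * ∫ x, K x := by
  unfold symmTranslate
  rw [integral_add (hK.integrable.comp_sub_right h) (hK.integrable.comp_add_right h),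
    integral_sub_right_eq_self, integral_add_right_eq_self]
  ring

/-- By evenness the half-line carries half of the mass `2 ∫ K`, so the averages of `D` over `(0, ∞)`
have a normalization independent of `h`. -/
theorem setIntegral_symmTranslate (hK : IsTauberianKernel K) (h : ℝ) :
    ∫ x in Set.Ioi 0, symmTranslate K h x = ∫ x, K x := by
  have h1 := integral_comp_abs (f := symmTranslate K h)
  have h2 : (fun x => symmTranslate K h |x|) = symmTranslate K h := by
    ext x
    rcases abs_choice x with hx | hx <;> rw [hx]
    exact hK.symmTranslate_neg h x
  rw [h2, hK.integral_symmTranslate] at h1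
  linarith

/-- The symmetrized translates converge to zero uniformly on bounded sets. -/
theorem eventually_symmTranslate_lt (hK : IsTauberianKernel K) {ε : ℝ} (hε : 0 < ε) (N : ℝ) :
    ∀ᶠ h in atTop, ∀ x, |x| ≤ N → symmTranslate K h x < ε := by
  obtain ⟨R, -, hR⟩ := hK.eventually_lt (half_pos hε)
  filter_upwards [eventually_ge_atTop (N + R)] with h hh x hx
  have hx' := abs_le.1 hx
  have h1 := hR (x - h) (by rw [abs_sub_comm]; exact le_trans (by linarith) (le_abs_self _))
  have h2 := hR (x + h) (le_trans (by linarith) (le_abs_self _))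
  unfold symmTranslate
  linarith

end IsTauberianKernel

/-- Test functions are real, so the modulation `exp (iht)` that would give a single translate is
replaced by `2 cos (ht)`. The extra translate lives near `-h`. -/
theorem fourierIntegral_two_cos_mul {φ K : ℝ → ℝ} (hφ : Integrable φ)
    (hK : ∀ x, fourierIntegral (fun t => (φ t : ℂ)) x = K x) (h x : ℝ) :
    fourierIntegral (fun t => ((2 * Real.cos (h * t) * φ t : ℝ) : ℂ)) x = symmTranslate K h x := by
  have hexp : ∀ x : ℝ, Integrable fun t : ℝ => Complex.exp (-Complex.I * x * t) * (φ t : ℂ) := by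
    intro x
    refine hφ.ofReal.bdd_mul (c := 1) (by fun_prop) (ae_of_all _ fun t => ?_)
    rw [Complex.norm_exp]
    simp
  unfold symmTranslate
  push_cast
  rw [← hK, ← hK]
  unfold fourierIntegral
  rw [← integral_add (hexp _) (hexp _)]
  congr 1 with t
  push_cast
  rw [Complex.cos]
  have h1 : Complex.exp (-Complex.I * (x - h) * t)
      = Complex.exp (-Complex.I * x * t) * Complex.exp (h * t * Complex.I) := by
    rw [← Complex.exp_add]; ring_nf
  have h2 : Complex.exp (-Complex.I * (x + h) * t)
      = Complex.exp (-Complex.I * x * t) * Complex.exp (-(h * t) * Complex.I) := by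
    rw [← Complex.exp_add]; ring_nf
  rw [h1, h2]
  ring

theorem fourierIntegral_comp_mul_left {φ K : ℝ → ℝ}
    (hK : ∀ x, fourierIntegral (fun t => (φ t : ℂ)) x = K x) {L : ℝ} (hL : 0 < L) (x : ℝ) :
    fourierIntegral (fun t => (φ (L * t) : ℂ)) x = ((L⁻¹ * K (x / L) : ℝ) : ℂ) := by
  push_cast
  rw [← hK]
  have := Measure.integral_comp_mul_left
    (fun t : ℝ => Complex.exp (-Complex.I * ((x / L : ℝ) : ℂ) * t) * (φ t : ℂ)) L
  rw [abs_of_pos (inv_pos.2 hL), Complex.real_smul] at this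
  unfold fourierIntegral
  push_cast at this
  push_cast
  rw [← this]
  congr 1 with t
  have : (L : ℂ) ≠ 0 := by exact_mod_cast hL.ne'
  field_simp

/-! ### The `L¹` modulus of continuity -/

/-- The `L¹` norm of the difference between `W` and its translate by `y`. -/
noncomputable def translationModulus (W : ℝ → ℝ) (y : ℝ) : ℝ := ∫ x, |W (x + y) - W x|

theorem translationModulus_nonneg (W : ℝ → ℝ) (y : ℝ) : 0 ≤ translationModulus W y :=
  integral_nonneg fun _ => abs_nonneg _

theorem translationModulus_le {W : ℝ → ℝ} (hW : Integrable W) (y : ℝ) :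
    translationModulus W y ≤ 2 * ∫ x, |W x| := by
  have h1 : Integrable fun x => |W (x + y)| := (hW.comp_add_right y).abs
  calc translationModulus W y ≤ ∫ x, (|W (x + y)| + |W x|) :=
        integral_mono ((hW.comp_add_right y).sub hW).abs (h1.add hW.abs) fun x => abs_sub _ _
    _ = _ := by
        rw [integral_add h1 hW.abs, integral_add_right_eq_self (fun x => |W x|)]
        ring

theorem stronglyMeasurable_translationModulus {W : ℝ → ℝ} (hW : Continuous W) :
    StronglyMeasurable (translationModulus W) :=
  StronglyMeasurable.integral_prod_right (f := fun y x : ℝ => |W (x + y) - W x|)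
    (by fun_prop : Continuous fun p : ℝ × ℝ => |W (p.2 + p.1) - W p.2|).stronglyMeasurable

/-- The bound does not involve `h`; this is the source of uniformity in `h`. -/
theorem translationModulus_symmTranslate_le {K : ℝ → ℝ} (hK : Integrable K) (h y : ℝ) :
    translationModulus (symmTranslate K h) y ≤ 2 * translationModulus K y := by
  have hi : Integrable fun x => |K (x + y) - K x| := ((hK.comp_add_right y).sub hK).abs
  have hs : Integrable (symmTranslate K h) :=
    (hK.comp_sub_right h).add (hK.comp_add_right h)
  calc translationModulus (symmTranslate K h) y
      ≤ ∫ x, (|K (x - h + y) - K (x - h)| + |K (x + h + y) - K (x + h)|) := by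
        refine integral_mono ((hs.comp_add_right y).sub hs).abs
          ((hi.comp_sub_right h).add (hi.comp_add_right h)) fun x => ?_
        refine le_trans (le_of_eq ?_) (abs_add_le _ _)
        simp only [symmTranslate]
        ring_nf
    _ = _ := by
        rw [integral_add (hi.comp_sub_right h) (hi.comp_add_right h),
          integral_sub_right_eq_self (fun x => |K (x + y) - K x|),
          integral_add_right_eq_self (fun x => |K (x + y) - K x|)]
        unfold translationModulus
        ring

theorem translationModulus_rescale (K : ℝ → ℝ) {L : ℝ} (hL : 0 < L) (y : ℝ) :
    translationModulus (fun x => L⁻¹ * K (x / L)) y = translationModulus K (y / L) := by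
  have := Measure.integral_comp_div (fun x => |K (x + y / L) - K x|) L
  rw [abs_of_pos hL, smul_eq_mul] at this
  unfold translationModulus
  simp_rw [← mul_sub, abs_mul, abs_of_pos (inv_pos.2 hL), add_div]
  rw [integral_const_mul, this, inv_mul_cancel_left₀ hL.ne']

theorem IsTauberianKernel.tendsto_translationModulus {K : ℝ → ℝ} (hK : IsTauberianKernel K) :
    Tendsto (translationModulus K) (𝓝 0) (𝓝 0) := by
  obtain ⟨C, hC⟩ := hK.decay
  have hC0 : 0 ≤ C := by simpa using (hK.nonneg 0).trans (hC 0)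
  have hc := hK.continuous
  have : Tendsto (fun y => ∫ x, |K (x + y) - K x|) (𝓝 0) (𝓝 (∫ _ : ℝ, (0 : ℝ))) := by
    refine tendsto_integral_filter_of_dominated_convergence
      -- Here `4 = 1 + 3`: for `|y| < 1` one has `1 + x ^ 2 ≤ 3 * (1 + (x + y) ^ 2)`.
      (fun x => 4 * C * (1 + x ^ 2)⁻¹)
      (Eventually.of_forall fun y => (by fun_prop : Continuous _).aestronglyMeasurable) ?_
      (integrable_inv_one_add_sq.const_mul _) (ae_of_all _ fun x => ?_)
    · filter_upwards [Metric.ball_mem_nhds (0 : ℝ) one_pos] with y hy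
      refine ae_of_all _ fun x => ?_
      rw [mem_ball_zero_iff, Real.norm_eq_abs, abs_lt] at hy
      rw [Real.norm_eq_abs, abs_abs, ← div_eq_mul_inv]
      have h1 := hC x
      have h2 : K (x + y) ≤ 3 * C / (1 + x ^ 2) := by
        refine (hC _).trans ?_
        rw [div_le_div_iff₀ (by positivity) (by positivity)]
        have : 1 + x ^ 2 ≤ 3 * (1 + (x + y) ^ 2) := by nlinarith [sq_nonneg (x + 2 * y)]
        nlinarith
      have h3 : 4 * C / (1 + x ^ 2) = C / (1 + x ^ 2) + 3 * C / (1 + x ^ 2) := by ring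
      refine (abs_sub _ _).trans ?_
      rw [abs_of_nonneg (hK.nonneg _), abs_of_nonneg (hK.nonneg _)]
      linarith
    · have : Continuous fun y => |K (x + y) - K x| := by fun_prop
      simpa using this.tendsto 0
  rw [integral_zero] at this
  exact this

/-- Averages at scale `L` of the modulus of continuity against an integrable weight vanish. -/
theorem IsTauberianKernel.tendsto_integral_translationModulus {K : ℝ → ℝ}
    (hK : IsTauberianKernel K) {f : ℝ → ℂ} (hf : Integrable f) :
    Tendsto (fun L : ℝ => ∫ y, ‖f y‖ * translationModulus K (y / L)) atTop (𝓝 0) := by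
  have : Tendsto (fun L : ℝ => ∫ y, ‖f y‖ * translationModulus K (y / L)) atTop
      (𝓝 (∫ _ : ℝ, (0 : ℝ))) := by
    refine tendsto_integral_filter_of_dominated_convergence
      (fun y => ‖f y‖ * (2 * ∫ x, |K x|)) (Eventually.of_forall fun L => ?_)
      (Eventually.of_forall fun L => ae_of_all _ fun y => ?_)
      (hf.norm.mul_const _) (ae_of_all _ fun y => ?_)
    · exact hf.norm.aestronglyMeasurable.mul
        ((stronglyMeasurable_translationModulus hK.continuous).comp_measurable
          (measurable_id.div_const L)).aestronglyMeasurable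
    · rw [norm_mul, norm_norm, Real.norm_of_nonneg (translationModulus_nonneg _ _)]
      gcongr
      exact translationModulus_le hK.integrable _
    · have h1 : Tendsto (fun L : ℝ => y / L) atTop (𝓝 0) := tendsto_const_nhds.div_atTop tendsto_id
      simpa using (hK.tendsto_translationModulus.comp h1).const_mul ‖f y‖
  simpa using this

/-! ### Pairings with bounded functions -/

/-- If `f₁` has mean zero, the pairing of `f₁ ∗ f₂` with `W` is controlled by the modulus of
continuity of `W`. -/
theorem norm_integral_convolution_mul_le {f₁ f₂ : ℝ → ℂ} (hf₁ : Integrable f₁)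
    (hf₂ : AEStronglyMeasurable f₂) {M : ℝ} (hM : ∀ᵐ x, ‖f₂ x‖ ≤ M) (h0 : ∫ y, f₁ y = 0)
    {W : ℝ → ℝ} (hWc : Continuous W) (hW : Integrable W) :
    ‖∫ x, (∫ y, f₁ y * f₂ (x - y)) * (W x : ℂ)‖
      ≤ M * ∫ y, ‖f₁ y‖ * translationModulus W y := by
  have hmeas : AEStronglyMeasurable (fun p : ℝ × ℝ => f₁ p.2 * f₂ (p.1 - p.2) * (W p.1 : ℂ))
      (volume.prod volume) := by
    refine AEStronglyMeasurable.mul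
      (AEStronglyMeasurable.convolution_integrand (ContinuousLinearMap.mul ℝ ℂ)
        hf₁.aestronglyMeasurable hf₂) ?_
    exact (by fun_prop : Continuous fun p : ℝ × ℝ => (W p.1 : ℂ)).aestronglyMeasurable
  have hint : Integrable (fun p : ℝ × ℝ => f₁ p.2 * f₂ (p.1 - p.2) * (W p.1 : ℂ))
      (volume.prod volume) := by
    refine ((hW.abs.mul_prod hf₁.norm).const_mul M).mono' hmeas ?_
    have hae : ∀ᵐ p : ℝ × ℝ ∂(volume.prod volume), ‖f₂ (p.1 - p.2)‖ ≤ M :=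
      (quasiMeasurePreserving_sub_of_right_invariant volume volume).ae hM
    filter_upwards [hae] with p hp
    rw [norm_mul, norm_mul, Complex.norm_real, Real.norm_eq_abs]
    calc ‖f₁ p.2‖ * ‖f₂ (p.1 - p.2)‖ * |W p.1| ≤ ‖f₁ p.2‖ * M * |W p.1| := by gcongr
      _ = _ := by ring
  have hshift : ∀ y, Integrable fun x => f₂ x * (W (x + y) : ℂ) := fun y =>
    (hW.comp_add_right y).ofReal.bdd_mul hf₂ hM
  have hbase : Integrable fun x => f₂ x * (W x : ℂ) := hW.ofReal.bdd_mul hf₂ hM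
  -- Fubini moves the translation from `f₂` onto `W`.
  have h1 : ∫ x, (∫ y, f₁ y * f₂ (x - y)) * (W x : ℂ)
      = ∫ y, f₁ y * ∫ x, f₂ x * (W (x + y) : ℂ) := by
    simp_rw [← integral_mul_const]
    rw [integral_integral_swap hint]
    congr 1 with y
    rw [← integral_sub_right_eq_self (fun x => f₂ x * (W (x + y) : ℂ)) y, ← integral_const_mul]
    congr 1 with x
    rw [sub_add_cancel, mul_assoc]
  have hfi : Integrable fun y => f₁ y * ∫ x, f₂ x * (W (x + y) : ℂ) := by
    refine hint.swap.integral_prod_left.congr (ae_of_all _ fun y => ?_)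
    simp only [Function.comp_apply, Prod.swap]
    rw [← integral_sub_right_eq_self (fun x => f₂ x * (W (x + y) : ℂ)) y, ← integral_const_mul]
    congr 1 with x
    rw [sub_add_cancel, mul_assoc]
  -- Mean zero allows the `y`-independent quantity `∫ f₂ W` to be subtracted.
  have h2 : ∫ y, f₁ y * ∫ x, f₂ x * (W (x + y) : ℂ)
      = ∫ y, f₁ y * ∫ x, f₂ x * ((W (x + y) - W x : ℝ) : ℂ) := by
    have : ∀ y, f₁ y * ∫ x, f₂ x * ((W (x + y) - W x : ℝ) : ℂ)
        = f₁ y * (∫ x, f₂ x * (W (x + y) : ℂ)) - f₁ y * ∫ x, f₂ x * (W x : ℂ) := by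
      intro y
      rw [← mul_sub, ← integral_sub (hshift y) hbase]
      congr 2 with x
      push_cast
      ring
    simp_rw [this]
    rw [integral_sub hfi (hf₁.mul_const _), integral_mul_const, h0, zero_mul, sub_zero]
  rw [h1, h2, ← integral_const_mul]
  refine norm_integral_le_of_norm_le ?_ (ae_of_all _ fun y => ?_)
  · refine Integrable.const_mul ?_ M
    refine (hf₁.norm.mul_const (2 * ∫ x, |W x|)).mono' (hf₁.norm.aestronglyMeasurable.mul
      (stronglyMeasurable_translationModulus hWc).aestronglyMeasurable) (ae_of_all _ fun y => ?_)
    rw [norm_mul, norm_norm, Real.norm_of_nonneg (translationModulus_nonneg _ _)]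
    gcongr
    exact translationModulus_le hW _
  · have hd : Integrable fun x => |W (x + y) - W x| := ((hW.comp_add_right y).sub hW).abs
    have : ‖∫ x, f₂ x * ((W (x + y) - W x : ℝ) : ℂ)‖ ≤ M * translationModulus W y := by
      unfold translationModulus
      rw [← integral_const_mul]
      refine norm_integral_le_of_norm_le (hd.const_mul M) ?_
      filter_upwards [hM] with x hx
      rw [norm_mul, Complex.norm_real, Real.norm_eq_abs]
      gcongr
    rw [norm_mul]
    calc _ ≤ ‖f₁ y‖ * (M * translationModulus W y) := by gcongr
      _ = _ := by ring

theorem ae_norm_le_of_memLp_top {f : ℝ → ℂ} (hf : MemLp f ⊤) : ∃ M, 0 ≤ M ∧ ∀ᵐ x, ‖f x‖ ≤ M := by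
  refine ⟨(eLpNorm f ⊤ volume).toReal, ENNReal.toReal_nonneg, ?_⟩
  have := ae_le_eLpNormEssSup (f := f) (μ := volume)
  filter_upwards [this] with x hx
  rw [← toReal_enorm]
  exact ENNReal.toReal_mono hf.eLpNorm_ne_top (by simpa [eLpNorm_exponent_top] using hx)

/-- If `f₁` has mean zero, the pairings of `f₁ ∗ f₂` with the symmetrized translates of a
sufficiently flat rescaling of a kernel are uniformly small. -/
theorem IsTauberianKernel.eventually_norm_integral_convolution_mul_le {K : ℝ → ℝ}
    (hK : IsTauberianKernel K) {f₁ f₂ : ℝ → ℂ} (hf₁ : Integrable f₁) (hf₂ : MemLp f₂ ⊤)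
    (h0 : ∫ y, f₁ y = 0) {ε : ℝ} (hε : 0 < ε) :
    ∀ᶠ L : ℝ in atTop, ∀ h, ‖∫ x, (∫ y, f₁ y * f₂ (x - y)) *
      (symmTranslate (fun x => L⁻¹ * K (x / L)) h x : ℂ)‖ ≤ ε := by
  obtain ⟨M, hM0, hM⟩ := ae_norm_le_of_memLp_top hf₂
  -- The factor 2 accounts for the two translates.
  have hlim := (hK.tendsto_integral_translationModulus hf₁).const_mul (M * 2)
  rw [mul_zero] at hlim
  filter_upwards [hlim.eventually (gt_mem_nhds hε), eventually_ge_atTop 1] with L hL hL1 h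
  have hKL := hK.rescale hL1
  refine (norm_integral_convolution_mul_le hf₁ hf₂.aestronglyMeasurable hM h0
    (hKL.symmTranslate_continuous h) (hKL.symmTranslate_integrable h)).trans (le_trans ?_ hL.le)
  rw [mul_assoc, ← integral_const_mul (2 : ℝ)]
  refine mul_le_mul_of_nonneg_left (integral_mono_of_nonneg (ae_of_all _ fun y =>
    mul_nonneg (norm_nonneg (f₁ y)) (translationModulus_nonneg _ _)) ?_ (ae_of_all _ fun y => ?_)) hM0
  · refine Integrable.const_mul ?_ 2
    refine (hf₁.norm.mul_const (2 * ∫ x, |K x|)).mono' (hf₁.norm.aestronglyMeasurable.mul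
      ((stronglyMeasurable_translationModulus hK.continuous).comp_measurable
          (measurable_id.div_const L)).aestronglyMeasurable) (ae_of_all _ fun y => ?_)
    rw [norm_mul, norm_norm, Real.norm_of_nonneg (translationModulus_nonneg _ _)]
    gcongr
    exact translationModulus_le hK.integrable _
  · calc _ ≤ ‖f₁ y‖ * (2 * translationModulus (fun x => L⁻¹ * K (x / L)) y) :=
          mul_le_mul_of_nonneg_left (translationModulus_symmTranslate_le hKL.integrable h y)
            (norm_nonneg _)
      _ = _ := by
          rw [translationModulus_rescale K (by linarith)]
          ring

/-- The pairings of a bounded function vanishing at infinity with the symmetrized translates of a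
kernel tend to zero. -/
theorem IsTauberianKernel.eventually_norm_integral_mul_le {K : ℝ → ℝ}
    (hK : IsTauberianKernel K) {f : ℝ → ℂ} (hf : MemLp f ⊤)
    (hf0 : Tendsto f (cocompact ℝ ⊓ ae volume) (𝓝 0)) {ε : ℝ} (hε : 0 < ε) :
    ∀ᶠ h : ℝ in atTop, ‖∫ x, f x * (symmTranslate K h x : ℂ)‖ ≤ ε := by
  obtain ⟨M, hM0, hM⟩ := ae_norm_le_of_memLp_top hf
  set m := ∫ x, K x
  have hm : 0 < m := hK.integral_pos
  set ε₁ := ε / (4 * m) with hε₁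
  have hε₁0 : 0 < ε₁ := by positivity
  obtain ⟨N, hN0, hN⟩ : ∃ N : ℝ, 0 < N ∧ ∀ᵐ x, N < |x| → ‖f x‖ ≤ ε₁ := by
    have h1 : ∀ᶠ x in cocompact ℝ ⊓ ae volume, ‖f x‖ < ε₁ := by
      have := hf0.norm
      rw [norm_zero] at this
      exact this.eventually (gt_mem_nhds hε₁0)
    obtain ⟨A, hA, hA'⟩ := Filter.eventually_inf.1 h1
    obtain ⟨B, hB, hAB⟩ := hA'
    obtain ⟨T, hT, hTA⟩ := mem_cocompact.1 hA
    obtain ⟨N, hN⟩ := hT.isBounded.subset_closedBall (0 : ℝ)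
    refine ⟨max N 1, by positivity, ?_⟩
    filter_upwards [hB] with x hx hxN
    refine (hAB x ⟨hTA fun hxT => ?_, hx⟩).le
    have := hN hxT
    rw [mem_closedBall_zero_iff, Real.norm_eq_abs] at this
    exact absurd ((le_max_left _ _).trans_lt hxN) (not_lt.2 this)
  -- Half of `ε` is for `|x| > N`, where `f` is small and `W` has mass at most `2m`; half is for
  -- `[-N, N]`, of length `2N`, where `W` is small. `M + 1` avoids dividing by zero.
  set ε₂ := ε / (4 * (M + 1) * N) with hε₂
  have hε₂0 : 0 < ε₂ := by positivity
  filter_upwards [hK.eventually_symmTranslate_lt hε₂0 N] with h hh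
  have hW := hK.symmTranslate_integrable h
  have hI : Integrable ((Set.Icc (-N) N).indicator fun _ : ℝ => M * ε₂) :=
    (integrable_indicator_iff measurableSet_Icc).2 (integrableOn_const (by simp) ENNReal.coe_ne_top)
  refine (norm_integral_le_of_norm_le ((hW.const_mul ε₁).add hI) ?_).trans ?_
  · filter_upwards [hM, hN] with x hxM hxN
    rw [norm_mul, Complex.norm_real, Real.norm_of_nonneg (hK.symmTranslate_nonneg h x),
      Pi.add_apply]
    have hp := hK.symmTranslate_nonneg h x
    by_cases hx : |x| ≤ N
    · rw [Set.indicator_of_mem (Set.mem_Icc.2 (abs_le.1 hx))]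
      have h1 := hh x hx
      have : ‖f x‖ * symmTranslate K h x ≤ M * ε₂ := by gcongr
      have : 0 ≤ ε₁ * symmTranslate K h x := by positivity
      linarith
    · rw [Set.indicator_of_notMem (s := Set.Icc (-N) N) (fun hx' => hx (abs_le.2 hx')), add_zero]
      gcongr
      exact hxN (not_le.1 hx)
  · rw [integral_add' (hW.const_mul ε₁) hI, integral_const_mul, hK.integral_symmTranslate,
      integral_indicator measurableSet_Icc, setIntegral_const, Real.volume_real_Icc,
      max_eq_left (by linarith), smul_eq_mul]
    have e1 : ε₁ * (2 * m) = ε / 2 := by rw [hε₁]; field_simp; ring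
    have e2 : (N - -N) * ((M + 1) * ε₂) = ε / 2 := by rw [hε₂]; field_simp; ring
    have e3 : (N - -N) * (M * ε₂) ≤ (N - -N) * ((M + 1) * ε₂) := by
      have : 0 ≤ N - -N := by linarith
      gcongr
      linarith
    change ε₁ * (2 * m) + _ ≤ _
    linarith

/-! ### Consequences of the Tauberian condition -/

/-- The slow decrease condition, iterated over steps of length `δ`, for the function
`S(x) / e^x`. -/
theorem StronglyLogLinearlySlowlyDecreasing.exists_antitone {S : ℝ → ℝ}
    (hS : StronglyLogLinearlySlowlyDecreasing S) :
    ∃ (η : ℝ → ℝ) (x₀ : ℝ), 0 < x₀ ∧ (∀ x, 0 ≤ x → 0 < η x) ∧ AntitoneOn η (Set.Ici 0) ∧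
      Tendsto η atTop (𝓝 0) ∧ ∀ x y, x₀ ≤ x → x ≤ y →
        Real.exp (x - y) * (S x * Real.exp (-x)) - η x ≤ S y * Real.exp (-y) := by
  obtain ⟨η, hpos, hanti, hlim, δ, hδ, x₀, hx₀, h⟩ := hS
  set r := Real.exp (-δ)
  have hr1 : r < 1 := Real.exp_lt_one_iff.2 (by linarith)
  have hr0 : 0 < r := Real.exp_pos _
  -- Sum of the geometric series in `r = exp (-δ)`: relative to `exp y`, the errors of successive
  -- steps back from `y` decay like powers of `r`.
  set C := (1 - r)⁻¹
  have hC : C * (1 - r) = 1 := inv_mul_cancel₀ (by linarith)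
  have hC1 : 1 ≤ C := (one_le_inv₀ (by linarith)).2 (by linarith)
  have hstep : ∀ x y, x₀ ≤ x → x ≤ y → y ≤ x + δ → -(η x * Real.exp x) ≤ S y - S x := by
    intro x y h1 h2 h3
    have := h x y h1 h2 h3
    rw [le_div_iff₀ (Real.exp_pos x)] at this
    linarith
  have hind : ∀ n : ℕ, ∀ x y, x₀ ≤ x → x ≤ y → y ≤ x + (n + 1) * δ →
      -(C * η x * Real.exp y) ≤ S y - S x := by
    intro n
    induction n with
    | zero =>
      intro x y h1 h2 h3
      have h4 := hstep x y h1 h2 (by simpa using h3)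
      have h5 : η x * Real.exp x ≤ C * η x * Real.exp y := by
        have := hpos x (by linarith)
        have : η x ≤ C * η x := by nlinarith
        gcongr
      linarith
    | succ n ih =>
      intro x y h1 h2 h3
      push_cast at h3
      have hη := hpos x (by linarith)
      by_cases hxy : y ≤ x + δ
      · have h4 := hstep x y h1 h2 hxy
        have h5 : η x * Real.exp x ≤ C * η x * Real.exp y := by
          have : η x ≤ C * η x := by nlinarith
          gcongr
        linarith
      · push Not at hxy
        -- Peeling off the last step leaves weight `exp (y - δ) = r * exp y`, and `C * r + r ≤ C`
        -- closes the induction.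
        have h4 := ih x (y - δ) h1 (by linarith) (by linarith)
        have h5 := hstep (y - δ) y (by linarith) (by linarith) (by linarith)
        have h6 : η (y - δ) ≤ η x :=
          hanti (Set.mem_Ici.2 (by linarith)) (Set.mem_Ici.2 (by linarith)) (by linarith)
        have h7 : Real.exp (y - δ) = Real.exp y * r := by
          rw [← Real.exp_add]; rfl
        rw [h7] at h4 h5
        have h8 : η (y - δ) * (Real.exp y * r) ≤ η x * (Real.exp y * r) := by gcongr
        have h9 : C * η x * (Real.exp y * r) + η x * (Real.exp y * r)
            ≤ C * η x * Real.exp y := by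
          have : C * r + r ≤ C := by nlinarith
          have h10 : 0 ≤ η x * Real.exp y := by positivity
          nlinarith
        linarith
  refine ⟨fun x => C * η x, x₀, hx₀, fun x hx => mul_pos (by linarith) (hpos x hx),
    fun x hx y hy hxy => mul_le_mul_of_nonneg_left (hanti hx hy hxy) (by linarith),
    by simpa using hlim.const_mul C, fun x y h1 h2 => ?_⟩
  obtain ⟨n, hn⟩ := exists_nat_ge ((y - x) / δ)
  rw [div_le_iff₀ hδ] at hn
  have h3 := hind n x y h1 h2 (by linarith)
  have h4 : Real.exp (x - y) * (S x * Real.exp (-x)) = S x * Real.exp (-y) := by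
    rw [mul_comm, mul_assoc, ← Real.exp_add]
    ring_nf
  have h5 : Real.exp y * Real.exp (-y) = 1 := by rw [← Real.exp_add]; simp
  have h6 : C * η x * (Real.exp y * Real.exp (-y)) = C * η x := by rw [h5, mul_one]
  have h7 := mul_le_mul_of_nonneg_right h3 (Real.exp_pos (-y)).le
  rw [h4]
  linarith

/-! ### The Laplace transform as an absolutely convergent integral -/

/-- Beyond `x₀`, adding `M * exp (-ε x)` makes the integrand nonnegative, so convergence of the
improper integral already gives absolute convergence. -/
theorem integrableOn_exp_mul_of_laplaceConvergesAt {S : ℝ → ℝ}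
    (hS : LocallyIntegrableOn S (Set.Ici 0)) {x₀ M : ℝ} (hx₀ : 0 ≤ x₀)
    (hM : ∀ x, x₀ ≤ x → -M ≤ S x * Real.exp (-x)) {ε : ℝ} (hε : 0 < ε)
    (hconv : LaplaceConvergesAt S ((1 + ε : ℝ) : ℂ)) :
    IntegrableOn (fun x => Real.exp (-ε * x) * (S x * Real.exp (-x))) (Set.Ioi 0) := by
  obtain ⟨l, hl⟩ := hconv
  set f : ℝ → ℝ := fun x => Real.exp (-ε * x) * (S x * Real.exp (-x)) with hf
  have hlocal : ∀ b, IntegrableOn f (Set.Icc 0 b) := by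
    intro b
    have h1 : IntegrableOn S (Set.Icc 0 b) :=
      hS.integrableOn_compact_subset (fun x hx => hx.1) isCompact_Icc
    exact (h1.mul_continuousOn (by fun_prop) isCompact_Icc).continuousOn_mul
      (by fun_prop) isCompact_Icc
  have hint : ∀ b c, 0 ≤ b → 0 ≤ c → IntervalIntegrable f volume b c := fun b c hb hc =>
    ((hlocal (max b c)).mono_set (by
      intro x hx
      exact ⟨(le_min hb hc).trans hx.1, hx.2⟩)).intervalIntegrable
  have hpart : ∀ R, laplacePartial S ((1 + ε : ℝ) : ℂ) R = ((∫ x in (0 : ℝ)..R, f x : ℝ) : ℂ) := by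
    intro R
    rw [← intervalIntegral.integral_ofReal]
    unfold laplacePartial
    congr 1 with x
    have h1 : -((1 + ε : ℝ) : ℂ) * x = ((-ε * x + -x : ℝ) : ℂ) := by push_cast; ring
    rw [h1, ← Complex.ofReal_exp, Real.exp_add, hf]
    push_cast
    ring
  have hlim : Tendsto (fun R => ∫ x in (0 : ℝ)..R, f x) atTop (𝓝 l.re) := by
    refine ((Complex.continuous_re.tendsto l).comp hl).congr fun R => ?_
    rw [Function.comp_apply, hpart, Complex.ofReal_re]
  set b : ℝ → ℝ := fun x => M * Real.exp (-ε * x) with hb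
  have hbi : IntegrableOn b (Set.Ioi x₀) := (exp_neg_integrableOn_Ioi x₀ hε).const_mul M
  have hsum : IntegrableOn (fun x => f x + b x) (Set.Ioi x₀) := by
    refine integrableOn_Ioi_of_intervalIntegral_norm_tendsto
      (l.re - (∫ x in (0 : ℝ)..x₀, f x) + ∫ x in Set.Ioi x₀, b x) x₀ (fun R => ?_) tendsto_id ?_
    · exact ((hlocal R).mono_set fun x hx => ⟨hx₀.trans hx.1.le, hx.2⟩).add
        (hbi.mono_set fun x hx => hx.1)
    · refine ((hlim.sub_const _).add
        (intervalIntegral_tendsto_integral_Ioi x₀ hbi tendsto_id)).congr' ?_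
      filter_upwards [eventually_ge_atTop x₀] with R hR
      have hnn : ∀ x ∈ Set.uIcc x₀ R, ‖f x + b x‖ = f x + b x := by
        intro x hx
        rw [Set.uIcc_of_le hR] at hx
        refine Real.norm_of_nonneg ?_
        have h1 := hM x hx.1
        have h2 := Real.exp_pos (-ε * x)
        simp only [hf, hb]
        nlinarith
      have hbint : IntervalIntegrable b volume x₀ R :=
        (by fun_prop : Continuous b).intervalIntegrable _ _
      rw [id, intervalIntegral.integral_congr hnn,
        intervalIntegral.integral_add (hint _ _ hx₀ (hx₀.trans hR)) hbint,
        ← intervalIntegral.integral_interval_sub_left (hint _ _ le_rfl (hx₀.trans hR))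
          (hint _ _ le_rfl hx₀)]
  have htail : IntegrableOn f (Set.Ioi x₀) := by
    refine (hsum.sub hbi).congr (ae_of_all _ fun x => ?_)
    simp
  rw [← Set.Ioc_union_Ioi_eq_Ioi hx₀]
  exact ((hlocal x₀).mono_set Set.Ioc_subset_Icc_self).union htail

theorem laplace_eq_setIntegral {S : ℝ → ℝ} {σ : ℝ}
    (hint : IntegrableOn (fun x => Real.exp (-(σ - 1) * x) * (S x * Real.exp (-x))) (Set.Ioi 0))
    (t : ℝ) :
    IntegrableOn (fun x : ℝ => Complex.exp (-Complex.I * x * t)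
      * ((Real.exp (-(σ - 1) * x) * (S x * Real.exp (-x)) : ℝ) : ℂ)) (Set.Ioi 0) ∧
    laplace S (σ + t * Complex.I) = ∫ x : ℝ in Set.Ioi 0, Complex.exp (-Complex.I * x * t)
      * ((Real.exp (-(σ - 1) * x) * (S x * Real.exp (-x)) : ℝ) : ℂ) := by
  have h1 : IntegrableOn (fun x : ℝ => Complex.exp (-Complex.I * x * t)
      * ((Real.exp (-(σ - 1) * x) * (S x * Real.exp (-x)) : ℝ) : ℂ)) (Set.Ioi 0) := by
    refine hint.ofReal.bdd_mul (c := 1) (by fun_prop) (ae_of_all _ fun x => ?_)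
    rw [Complex.norm_exp]
    simp
  refine ⟨h1, ?_⟩
  have h2 : laplacePartial S (σ + t * Complex.I) = fun R : ℝ => ∫ x : ℝ in (0 : ℝ)..R,
      Complex.exp (-Complex.I * x * t)
        * ((Real.exp (-(σ - 1) * x) * (S x * Real.exp (-x)) : ℝ) : ℂ) := by
    ext R
    unfold laplacePartial
    congr 1 with x
    have h3 : -(σ + t * Complex.I) * x
        = -Complex.I * x * t + ((-(σ - 1) * x : ℝ) : ℂ) + ((-x : ℝ) : ℂ) := by
      push_cast; ring
    rw [h3, Complex.exp_add, Complex.exp_add]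
    push_cast
    ring
  unfold laplace
  rw [h2]
  exact (intervalIntegral_tendsto_integral_Ioi 0 h1 tendsto_id).limUnder_eq

/-- Pairing the Laplace transform on a vertical line with a test function. -/
theorem integral_laplace_sub_mul {S : ℝ → ℝ} {σ : ℝ} (hσ : 1 < σ)
    (hint : IntegrableOn (fun x => Real.exp (-(σ - 1) * x) * (S x * Real.exp (-x))) (Set.Ioi 0))
    (a : ℝ) {φ W : ℝ → ℝ} (hφ : Integrable φ)
    (hW : ∀ x, fourierIntegral (fun t => (φ t : ℂ)) x = W x) :
    ∫ t : ℝ, (laplace S (σ + t * Complex.I) - (a : ℂ) / (σ + t * Complex.I - 1)) * (φ t : ℂ)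
      = ((∫ x in Set.Ioi 0,
          Real.exp (-(σ - 1) * x) * ((S x * Real.exp (-x) - a) * W x) : ℝ) : ℂ) := by
  set q : ℝ → ℝ := fun x => Real.exp (-(σ - 1) * x) * (S x * Real.exp (-x) - a) with hq
  have hexp : IntegrableOn (fun x => Real.exp (-(σ - 1) * x)) (Set.Ioi 0) :=
    exp_neg_integrableOn_Ioi 0 (by linarith)
  have hqi : IntegrableOn q (Set.Ioi 0) := by
    refine (hint.sub (hexp.mul_const a)).congr (ae_of_all _ fun x => ?_)
    simp only [hq, Pi.sub_apply]
    ring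
  have hG : ∀ t : ℝ, laplace S (σ + t * Complex.I) - (a : ℂ) / (σ + t * Complex.I - 1)
      = ∫ x : ℝ in Set.Ioi 0, Complex.exp (-Complex.I * x * t) * (q x : ℂ) := by
    intro t
    obtain ⟨hi, heq⟩ := laplace_eq_setIntegral hint t
    have hre : (-(σ + t * Complex.I - 1) : ℂ).re < 0 := by simp; linarith
    have h1 := integral_exp_mul_complex_Ioi hre 0
    have h2 := integrableOn_exp_mul_complex_Ioi hre 0
    -- The polar term is written as the Laplace transform of `a * exp x`, turning `D` into `D - a`.
    have h3 : (a : ℂ) / (σ + t * Complex.I - 1)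
        = ∫ x : ℝ in Set.Ioi 0, (a : ℂ) * Complex.exp (-(σ + t * Complex.I - 1) * x) := by
      rw [integral_const_mul, h1]
      simp only [Complex.ofReal_zero, mul_zero, Complex.exp_zero, neg_div_neg_eq]
      ring
    rw [heq, h3, ← integral_sub hi (h2.const_mul _)]
    congr 1 with x
    have h4 : -(σ + t * Complex.I - 1) * x
        = -Complex.I * x * t + ((-(σ - 1) * x : ℝ) : ℂ) := by push_cast; ring
    rw [h4, Complex.exp_add, ← Complex.ofReal_exp, hq]
    push_cast
    ring
  have hprod : Integrable (fun p : ℝ × ℝ => Complex.exp (-Complex.I * p.2 * p.1)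
      * ((φ p.1 : ℂ) * (q p.2 : ℂ))) (volume.prod (volume.restrict (Set.Ioi 0))) := by
    refine (hφ.ofReal.mul_prod hqi.ofReal).bdd_mul (c := 1)
      (by fun_prop : Continuous fun p : ℝ × ℝ =>
        Complex.exp (-Complex.I * p.2 * p.1)).aestronglyMeasurable (ae_of_all _ fun p => ?_)
    rw [Complex.norm_exp]
    simp
  calc ∫ t : ℝ, (laplace S (σ + t * Complex.I) - (a : ℂ) / (σ + t * Complex.I - 1)) * (φ t : ℂ)
      = ∫ t : ℝ, ∫ x : ℝ in Set.Ioi 0, Complex.exp (-Complex.I * x * t)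
          * ((φ t : ℂ) * (q x : ℂ)) := by
        congr 1 with t
        rw [hG, ← integral_mul_const]
        congr 1 with x
        ring
    _ = ∫ x : ℝ in Set.Ioi 0, ∫ t : ℝ, Complex.exp (-Complex.I * x * t)
          * ((φ t : ℂ) * (q x : ℂ)) := integral_integral_swap hprod
    _ = _ := by
        rw [← integral_complex_ofReal]
        congr 1 with x
        have : ((Real.exp (-(σ - 1) * x) * ((S x * Real.exp (-x) - a) * W x) : ℝ) : ℂ)
            = (q x : ℂ) * W x := by rw [hq]; push_cast; ring
        rw [this, ← hW, fourierIntegral, ← integral_const_mul]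
        congr 1 with t
        ring

/-! ### An Abelian limit -/

/-- If `f` is bounded below by an integrable function and its Abel means converge, then `f` is
integrable and its integral is the limit. -/
theorem integrableOn_and_setIntegral_eq_of_tendsto_abel {f b : ℝ → ℝ} {l : ℝ}
    (hf : ∀ ε > 0, IntegrableOn (fun x => Real.exp (-ε * x) * f x) (Set.Ioi 0))
    (hb : IntegrableOn b (Set.Ioi 0)) (hb0 : ∀ x ∈ Set.Ioi (0 : ℝ), 0 ≤ b x)
    (hfb : ∀ x ∈ Set.Ioi (0 : ℝ), -b x ≤ f x)
    (hlim : Tendsto (fun ε => ∫ x in Set.Ioi 0, Real.exp (-ε * x) * f x) (𝓝[>] 0) (𝓝 l)) :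
    IntegrableOn f (Set.Ioi 0) ∧ ∫ x in Set.Ioi 0, f x = l := by
  have hseq : Tendsto (fun n : ℕ => 1 / ((n : ℝ) + 1)) atTop (𝓝[>] 0) :=
    tendsto_nhdsWithin_iff.2 ⟨tendsto_one_div_add_atTop_nhds_zero_nat,
      Eventually.of_forall fun n => Set.mem_Ioi.2 Nat.one_div_pos_of_nat⟩
  have hpos : ∀ n : ℕ, 0 < 1 / ((n : ℝ) + 1) := fun n => Nat.one_div_pos_of_nat
  have hexp1 : ∀ ε : ℝ, 0 < ε → ∀ x ∈ Set.Ioi (0 : ℝ), Real.exp (-ε * x) ≤ 1 := by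
    intro ε hε x hx
    rw [Real.exp_le_one_iff, neg_mul, neg_nonpos]
    exact mul_nonneg hε.le (le_of_lt hx)
  have hbε : ∀ ε > 0, IntegrableOn (fun x => Real.exp (-ε * x) * b x) (Set.Ioi 0) := by
    intro ε hε
    refine Integrable.bdd_mul (c := 1) hb (by fun_prop) ?_
    refine (ae_restrict_iff' measurableSet_Ioi).2 (ae_of_all _ fun x hx => ?_)
    rw [Real.norm_of_nonneg (Real.exp_pos _).le]
    exact hexp1 ε hε x hx
  have hptw : ∀ (u : ℝ → ℝ) (x : ℝ),
      Tendsto (fun n : ℕ => Real.exp (-(1 / ((n : ℝ) + 1)) * x) * u x) atTop (𝓝 (u x)) := by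
    intro u x
    have h1 : Continuous fun ε : ℝ => Real.exp (-ε * x) * u x := by fun_prop
    have h2 := (h1.tendsto 0).comp (hseq.mono_right nhdsWithin_le_nhds)
    simp only [neg_zero, zero_mul, Real.exp_zero, one_mul] at h2
    exact h2
  obtain ⟨B, hB⟩ := (hlim.comp hseq).bddAbove_range
  -- Fatou's lemma for the nonnegative `f + b`, whose Abel means are bounded. Once `f` is
  -- integrable, it dominates its own Abel means.
  have hsum : IntegrableOn (fun x => f x + b x) (Set.Ioi 0) := by
    refine integrable_of_tendsto
      (G := fun n x => Real.exp (-(1 / ((n : ℝ) + 1)) * x) * (f x + b x))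
      (ae_of_all _ fun x => hptw (fun x => f x + b x) x) (fun n => ?_) ?_
    · simp_rw [mul_add]
      exact ((hf _ (hpos n)).add (hbε _ (hpos n))).aestronglyMeasurable
    · refine ne_top_of_le_ne_top (b := ENNReal.ofReal (B + ∫ x in Set.Ioi 0, b x))
        ENNReal.ofReal_ne_top ?_
      refine liminf_le_of_frequently_le' (Eventually.frequently (Eventually.of_forall fun n => ?_))
      have hi := (hf _ (hpos n)).add (hbε _ (hpos n))
      have h1 : ∀ᵐ x ∂(volume.restrict (Set.Ioi (0 : ℝ))),
          0 ≤ Real.exp (-(1 / ((n : ℝ) + 1)) * x) * (f x + b x) := by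
        refine (ae_restrict_iff' measurableSet_Ioi).2 (ae_of_all _ fun x hx => ?_)
        have := hfb x hx
        exact mul_nonneg (Real.exp_pos _).le (by linarith)
      have h2 : ∫⁻ x in Set.Ioi 0, ‖Real.exp (-(1 / ((n : ℝ) + 1)) * x) * (f x + b x)‖ₑ
          = ENNReal.ofReal
            (∫ x in Set.Ioi 0, Real.exp (-(1 / ((n : ℝ) + 1)) * x) * (f x + b x)) := by
        rw [ofReal_integral_eq_lintegral_ofReal (hi.congr (ae_of_all _ fun x => by
          simp [mul_add])) h1]
        refine lintegral_congr_ae ?_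
        filter_upwards [h1] with x hx
        exact Real.enorm_of_nonneg hx
      rw [h2]
      refine ENNReal.ofReal_le_ofReal ?_
      simp_rw [mul_add]
      rw [integral_add (hf _ (hpos n)) (hbε _ (hpos n))]
      refine add_le_add (hB ⟨n, rfl⟩) (setIntegral_mono_on (hbε _ (hpos n)) hb measurableSet_Ioi
        fun x hx => mul_le_of_le_one_left (hb0 x hx) (hexp1 _ (hpos n) x hx))
  have hfi : IntegrableOn f (Set.Ioi 0) := by
    refine (hsum.sub hb).congr (ae_of_all _ fun x => ?_)
    simp
  refine ⟨hfi, tendsto_nhds_unique ?_ (hlim.comp hseq)⟩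
  refine tendsto_integral_of_dominated_convergence (fun x => ‖f x‖)
    (fun n => (hf _ (hpos n)).aestronglyMeasurable) hfi.norm (fun n => ?_)
    (ae_of_all _ fun x => hptw f x)
  refine (ae_restrict_iff' measurableSet_Ioi).2 (ae_of_all _ fun x hx => ?_)
  rw [norm_mul, Real.norm_of_nonneg (Real.exp_pos _).le]
  exact mul_le_of_le_one_left (norm_nonneg _) (hexp1 _ (hpos n) x hx)

/-! ### From kernel averages to two-sided bounds -/

theorem IsTauberianKernel.exists_tail_integral_lt {K : ℝ → ℝ} (hK : IsTauberianKernel K) {ε : ℝ}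
    (hε : 0 < ε) : ∃ R > 0, ∫ x, {x : ℝ | R < |x|}.indicator K x < ε := by
  have h : Tendsto (fun R : ℝ => ∫ x, {x : ℝ | R < |x|}.indicator K x) atTop
      (𝓝 (∫ _ : ℝ, (0 : ℝ))) := by
    refine tendsto_integral_filter_of_dominated_convergence K
      (Eventually.of_forall fun R => hK.continuous.aestronglyMeasurable.indicator
        (measurableSet_lt measurable_const measurable_norm))
      (Eventually.of_forall fun R => ae_of_all _ fun x => ?_) hK.integrable
      (ae_of_all _ fun x => ?_)
    · refine (norm_indicator_le_norm_self _ _).trans (le_of_eq ?_)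
      exact Real.norm_of_nonneg (hK.nonneg x)
    · refine tendsto_const_nhds.congr' ?_
      filter_upwards [eventually_ge_atTop |x|] with R hR
      rw [Set.indicator_of_notMem]
      simpa using hR
  rw [integral_zero] at h
  obtain ⟨R, h1, h2⟩ := ((h.eventually (gt_mem_nhds hε)).and (eventually_gt_atTop 0)).exists
  exact ⟨R, h2, h1⟩

section Tauberian

variable {D η K : ℝ → ℝ} {x₀ : ℝ}

/-- Slow decrease started at `x₀`, with the factor `exp (x₀ - x)` at most `1`. -/
theorem neg_le_of_slowlyDecreasing
    (hD : ∀ x y, x₀ ≤ x → x ≤ y → Real.exp (x - y) * D x - η x ≤ D y) {x : ℝ} (hx : x₀ ≤ x) :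
    -(|D x₀| + η x₀) ≤ D x := by
  have h1 := hD x₀ x le_rfl hx
  have h2 : Real.exp (x₀ - x) ≤ 1 := by
    rw [Real.exp_le_one_iff]; linarith
  have h3 : -|D x₀| ≤ Real.exp (x₀ - x) * D x₀ := by
    have := neg_abs_le (D x₀)
    have := Real.exp_pos (x₀ - x)
    nlinarith [abs_nonneg (D x₀)]
  linarith

/-- Slow decrease and bounded kernel averages imply boundedness from above. -/
theorem IsTauberianKernel.exists_eventually_le (hK : IsTauberianKernel K) (hx₀ : 0 < x₀)
    (hη : ∀ x, 0 ≤ x → 0 < η x) (hanti : AntitoneOn η (Set.Ici 0))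
    (hD : ∀ x y, x₀ ≤ x → x ≤ y → Real.exp (x - y) * D x - η x ≤ D y)
    (hloc : IntegrableOn D (Set.Ioc 0 x₀)) {B : ℝ}
    (hB : ∀ᶠ h in atTop, IntegrableOn (fun x => D x * symmTranslate K h x) (Set.Ioi 0) ∧
      ∫ x in Set.Ioi 0, D x * symmTranslate K h x ≤ B) :
    ∃ M, ∀ᶠ x in atTop, D x ≤ M := by
  set κ := ∫ x in (0 : ℝ)..1, K x with hκ
  have hκ0 : 0 < κ := hK.intervalIntegral_pos
  set m := ∫ x, K x
  set M := |D x₀| + η x₀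
  have hM0 : 0 ≤ M := add_nonneg (abs_nonneg _) (hη x₀ hx₀.le).le
  have hlow : ∀ x, x₀ ≤ x → -M ≤ D x := fun x hx => neg_le_of_slowlyDecreasing hD hx
  set A := ∫ x in Set.Ioc 0 x₀, |D x|
  refine ⟨max 0 (Real.exp 1 * ((B + A + M * m) / κ)), ?_⟩
  filter_upwards [hB, hK.eventually_symmTranslate_lt one_pos x₀, eventually_ge_atTop x₀]
    with h ⟨hint, hle⟩ hsmall hh
  by_cases hDh : D h ≤ 0
  · exact hDh.trans (le_max_left _ _)
  push Not at hDh
  refine le_trans ?_ (le_max_right _ _)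
  have hWi := hK.symmTranslate_integrable h
  have hAi : IntegrableOn ((Set.Ioc 0 x₀).indicator fun x => |D x|) (Set.Ioi 0) :=
    ((integrable_indicator_iff measurableSet_Ioc).2 hloc.abs).integrableOn
  have hKi : IntegrableOn ((Set.Ioc h (h + 1)).indicator fun x => K (x - h)) (Set.Ioi 0) :=
    ((integrable_indicator_iff measurableSet_Ioc).2
      (hK.integrable.comp_sub_right h).integrableOn).integrableOn
  -- Pointwise minorant: slow decrease from `h` gives `D ≥ exp (-1) * D h - M` on `(h, h + 1]`;
  -- elsewhere beyond `x₀` only `D ≥ -M` is used, and on `(0, x₀]` the kernel is below `1`.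
  have hcomp := setIntegral_mono_on
    (((hKi.const_mul (Real.exp (-1) * D h)).sub (hWi.integrableOn.const_mul M)).sub hAi) hint
    measurableSet_Ioi (fun x hx => by
      have hW := hK.symmTranslate_nonneg h x
      have hKx := hK.nonneg (x - h)
      simp only [Pi.sub_apply]
      by_cases hx1 : x ≤ x₀
      · rw [Set.indicator_of_notMem (fun h' => absurd h'.1 (not_lt.2 (hx1.trans hh))),
          Set.indicator_of_mem (Set.mem_Ioc.2 ⟨hx, hx1⟩)]
        have h1 := hsmall x (by rwa [abs_of_pos hx])
        have h2 := neg_abs_le (D x)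
        have h3 := abs_nonneg (D x)
        nlinarith
      · push Not at hx1
        rw [Set.indicator_of_notMem (s := Set.Ioc 0 x₀) (fun h' => absurd h'.2 (not_le.2 hx1))]
        have h1 := hlow x hx1.le
        by_cases hx2 : x ∈ Set.Ioc h (h + 1)
        · rw [Set.indicator_of_mem hx2]
          have h2 := hD h x hh hx2.1.le
          have h3 : Real.exp (-1) ≤ Real.exp (h - x) := Real.exp_le_exp.2 (by linarith [hx2.2])
          have h4 : η h ≤ η x₀ := hanti hx₀.le (hx₀.le.trans hh) hh
          have h5 : η x₀ ≤ M := le_add_of_nonneg_left (abs_nonneg _)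
          have h6 : Real.exp (-1) * D h ≤ D x + M := by nlinarith
          have h7 : K (x - h) ≤ symmTranslate K h x := le_add_of_nonneg_right (hK.nonneg _)
          have h8 : 0 < Real.exp (-1) * D h := by positivity
          nlinarith
        · rw [Set.indicator_of_notMem hx2]
          nlinarith)
  have e1 : ∫ x in Set.Ioi 0, (Set.Ioc h (h + 1)).indicator (fun x => K (x - h)) x = κ := by
    rw [setIntegral_indicator measurableSet_Ioc, Set.inter_eq_right.2 (fun x hx =>
      Set.mem_Ioi.2 (by linarith [hx.1])), ← intervalIntegral.integral_of_le (by linarith),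
      intervalIntegral.integral_comp_sub_right]
    simp [hκ]
  have e2 : ∫ x in Set.Ioi 0, (Set.Ioc 0 x₀).indicator (fun x => |D x|) x = A := by
    rw [setIntegral_indicator measurableSet_Ioc, Set.inter_eq_right.2 (fun x hx => hx.1)]
  rw [integral_sub' ((hKi.const_mul _).sub (hWi.integrableOn.const_mul M)) hAi,
    integral_sub' (hKi.const_mul _) (hWi.integrableOn.const_mul M), integral_const_mul,
    integral_const_mul, hK.setIntegral_symmTranslate, e1, e2] at hcomp
  have h1 : Real.exp (-1) * D h ≤ (B + A + M * m) / κ := by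
    rw [le_div_iff₀ hκ0]
    change _ - M * m - A ≤ _ at hcomp
    linarith
  calc D h = Real.exp 1 * (Real.exp (-1) * D h) := by
        rw [← mul_assoc, ← Real.exp_add]; simp
    _ ≤ _ := by gcongr

/-- Slow decrease, boundedness from above, and kernel averages bounded away from zero imply a
positive lower bound. -/
theorem IsTauberianKernel.exists_pos_eventually_le (hK : IsTauberianKernel K) (hx₀ : 0 < x₀)
    (hηlim : Tendsto η atTop (𝓝 0))
    (hanti : AntitoneOn η (Set.Ici 0))
    (hD : ∀ x y, x₀ ≤ x → x ≤ y → Real.exp (x - y) * D x - η x ≤ D y)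
    (hloc : ∀ b, IntegrableOn D (Set.Ioc 0 b)) {M : ℝ} (hM : ∀ᶠ x in atTop, D x ≤ M)
    {β : ℝ} (hβ : 0 < β)
    (hB : ∀ᶠ h in atTop, IntegrableOn (fun x => D x * symmTranslate K h x) (Set.Ioi 0) ∧
      β ≤ ∫ x in Set.Ioi 0, D x * symmTranslate K h x) :
    ∃ c > 0, ∀ᶠ x in atTop, c ≤ D x := by
  set m := ∫ x, K x with hm
  have hm0 : 0 < m := hK.integral_pos
  obtain ⟨x₁, hx₁⟩ := eventually_atTop.1 (hM.and (eventually_ge_atTop x₀))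
  have hx₁₀ : x₀ ≤ x₁ := (hx₁ x₁ le_rfl).2
  set M' := max M 0
  have hM'0 : 0 ≤ M' := le_max_right _ _
  have hM' : ∀ x, x₁ ≤ x → D x ≤ M' := fun x hx => (hx₁ x hx).1.trans (le_max_left _ _)
  set A := ∫ x in Set.Ioc 0 x₁, |D x| with hA
  have hA0 : 0 ≤ A := integral_nonneg fun _ => abs_nonneg _
  obtain ⟨R, hR0, hR⟩ := hK.exists_tail_integral_lt (ε := β / (8 * (M' + 1))) (by positivity)
  set T : ℝ → ℝ := {x : ℝ | R < |x|}.indicator K with hT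
  have hT0 : ∀ x, 0 ≤ T x := fun x => Set.indicator_nonneg (fun x _ => hK.nonneg x) x
  have hTi : Integrable T := hK.integrable.indicator
    (measurableSet_lt measurable_const measurable_norm)
  set ε := β / (4 * (A + 1)) with hε
  have hε0 : 0 < ε := by positivity
  -- Chosen so that `D y < c` and `η < c` propagate back over length `2R` to `D ≤ q = β / (4m)`.
  set c := Real.exp (-(2 * R)) * (β / (8 * m)) with hc
  have hc0 : 0 < c := by positivity
  have hsub : ∀ r : ℝ, Tendsto (fun y : ℝ => y - r) atTop atTop :=
    fun r => tendsto_atTop_add_const_right _ _ tendsto_id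
  refine ⟨c, hc0, ?_⟩
  filter_upwards [(hsub R).eventually hB,
    (hsub R).eventually (hK.eventually_symmTranslate_lt hε0 x₁),
    (hsub (2 * R)).eventually (hηlim.eventually (gt_mem_nhds hc0)),
    eventually_ge_atTop (x₁ + 2 * R)] with y ⟨hint, hge⟩ hsmall hηy hy
  by_contra! hlt
  -- The window `|x - h| ≤ R` is `[y - 2R, y]`, lying before `y`, where slow decrease carries
  -- smallness backwards.
  set h := y - R with hh
  set q := Real.exp (2 * R) * (2 * c) with hq
  have hq' : q = β / (4 * m) := by
    rw [hq, hc]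
    calc _ = Real.exp (2 * R) * Real.exp (-(2 * R)) * (β / (4 * m)) := by field_simp; ring
      _ = _ := by rw [← Real.exp_add]; simp
  have hq0 : 0 < q := by positivity
  have hDq : ∀ x, |x - h| ≤ R → D x ≤ q := by
    intro x hx
    have hx' := abs_le.1 hx
    have h1 := hD x y (by linarith) (by linarith)
    have h2 : η x ≤ η (y - 2 * R) :=
      hanti (Set.mem_Ici.2 (by linarith)) (Set.mem_Ici.2 (by linarith)) (by linarith)
    have h3 : Real.exp (x - y) * D x ≤ 2 * c := by linarith
    calc D x = Real.exp (y - x) * (Real.exp (x - y) * D x) := by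
          rw [← mul_assoc, ← Real.exp_add]; simp
      _ ≤ Real.exp (y - x) * (2 * c) := by gcongr
      _ ≤ q := by
          rw [hq]
          gcongr
          linarith
  have hKi : Integrable fun x => K (x - h) := hK.integrable.comp_sub_right h
  have hAi : Integrable ((Set.Ioc 0 x₁).indicator fun x => |D x|) :=
    (integrable_indicator_iff measurableSet_Ioc).2 (hloc x₁).abs
  have hTi1 : Integrable fun x => T (x - h) := hTi.comp_sub_right h
  have hTi2 : Integrable fun x => T (x + h) := hTi.comp_add_right h
  -- Majorant of `D W`: the initial segment, the window, and the tails of the two translates. Its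
  -- integral is below `β/4 + β/4 + β/8 + β/8 < β`.
  set U : ℝ → ℝ := fun x => ε * (Set.Ioc 0 x₁).indicator (fun x => |D x|) x + q * K (x - h)
    + (M' * T (x - h) + M' * T (x + h)) with hU
  have hUi : Integrable U := ((hAi.const_mul ε).add (hKi.const_mul q)).add
    ((hTi1.const_mul M').add (hTi2.const_mul M'))
  have hind0 : ∀ x, 0 ≤ (Set.Ioc 0 x₁).indicator (fun x => |D x|) x :=
    fun x => Set.indicator_nonneg (fun x _ => abs_nonneg _) x
  have hU0 : ∀ x, 0 ≤ U x := fun x => add_nonneg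
    (add_nonneg (mul_nonneg hε0.le (hind0 x)) (mul_nonneg hq0.le (hK.nonneg _)))
    (add_nonneg (mul_nonneg hM'0 (hT0 _)) (mul_nonneg hM'0 (hT0 _)))
  have hcomp : ∫ x in Set.Ioi 0, D x * symmTranslate K h x ≤ ∫ x, U x := by
    refine (setIntegral_mono_on hint hUi.integrableOn measurableSet_Ioi fun x hx => ?_).trans
      (setIntegral_le_integral hUi (ae_of_all _ hU0))
    have hx0 : (0 : ℝ) < x := hx
    have hk1 := hK.nonneg (x - h)
    have hk2 := hK.nonneg (x + h)
    have ht1 := hT0 (x - h)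
    have ht2 := hT0 (x + h)
    simp only [hU]
    by_cases hx1 : x ≤ x₁
    · rw [Set.indicator_of_mem (Set.mem_Ioc.2 ⟨hx, hx1⟩)]
      have h1 := hsmall x (by rwa [abs_of_pos hx0])
      have h2 : D x * symmTranslate K h x ≤ ε * |D x| := by
        calc D x * symmTranslate K h x ≤ |D x| * symmTranslate K h x :=
              mul_le_mul_of_nonneg_right (le_abs_self _) (hK.symmTranslate_nonneg h x)
          _ ≤ |D x| * ε := by gcongr
          _ = _ := mul_comm _ _
      have h3 : 0 ≤ q * K (x - h) := by positivity
      have h4 : 0 ≤ M' * T (x - h) := by positivity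
      have h5 : 0 ≤ M' * T (x + h) := by positivity
      linarith
    · push Not at hx1
      rw [Set.indicator_of_notMem (s := Set.Ioc 0 x₁) (fun h' => absurd h'.2 (not_le.2 hx1)),
        mul_zero, zero_add]
      have h1 := hM' x hx1.le
      have e2 : T (x + h) = K (x + h) := by
        refine Set.indicator_of_mem ?_ _
        rw [Set.mem_ofPred_eq, abs_of_pos (by linarith)]
        linarith
      have h2 : D x * K (x + h) ≤ M' * T (x + h) := by rw [e2]; gcongr
      have h3 : D x * K (x - h) ≤ q * K (x - h) + M' * T (x - h) := by
        by_cases hx2 : |x - h| ≤ R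
        · have := mul_le_mul_of_nonneg_right (hDq x hx2) hk1
          have h4 : 0 ≤ M' * T (x - h) := by positivity
          linarith
        · have e1 : T (x - h) = K (x - h) :=
            Set.indicator_of_mem (s := {x : ℝ | R < |x|}) (not_le.1 hx2) _
          rw [e1]
          have := mul_le_mul_of_nonneg_right h1 hk1
          have h4 : 0 ≤ q * K (x - h) := by positivity
          linarith
      unfold symmTranslate
      linarith
  have hUint : ∫ x, U x = ε * A + q * m + ((M' * ∫ x, T x) + (M' * ∫ x, T x)) := by
    have i1 : Integrable fun x => ε * (Set.Ioc 0 x₁).indicator (fun x => |D x|) x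
        + q * K (x - h) := (hAi.const_mul ε).add (hKi.const_mul q)
    have i2 : Integrable fun x => M' * T (x - h) + M' * T (x + h) :=
      (hTi1.const_mul M').add (hTi2.const_mul M')
    simp only [hU]
    rw [integral_add i1 i2, integral_add (hAi.const_mul ε) (hKi.const_mul q),
      integral_add (hTi1.const_mul M') (hTi2.const_mul M')]
    simp_rw [integral_const_mul]
    rw [integral_sub_right_eq_self, integral_sub_right_eq_self, integral_add_right_eq_self,
      integral_indicator measurableSet_Ioc]
  have b1 : ε * A < β / 4 := by
    have : ε * (A + 1) = β / 4 := by rw [hε]; field_simp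
    linarith
  have b2 : q * m = β / 4 := by rw [hq']; field_simp
  have b3 : M' * ∫ x, T x ≤ β / 8 := by
    have h1 : (M' + 1) * (β / (8 * (M' + 1))) = β / 8 := by field_simp
    have h2 : 0 ≤ ∫ x, T x := integral_nonneg hT0
    nlinarith
  linarith

end Tauberian

/-! ### The boundary value -/

section BoundaryValue

variable {I : TopologicalSpace.Opens ℝ}

/-- Pairing the boundary value with a test function whose Fourier transform is nonnegative. -/
theorem IsBoundaryValue.integrableOn_and_norm_setIntegral_le {S : ℝ → ℝ}
    (hS : LocallyIntegrableOn S (Set.Ici 0)) {x₀ M : ℝ} (hx₀ : 0 ≤ x₀)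
    (hM : ∀ x, x₀ ≤ x → -M ≤ S x * Real.exp (-x))
    (hconv : ∀ s : ℂ, 1 < s.re → LaplaceConvergesAt S s) {a : ℝ} (ha : 0 ≤ a) {g : 𝓓'(I, ℂ)}
    (hg : IsBoundaryValue (fun s : ℂ => laplace S s - (a : ℂ) / (s - 1)) g)
    (φ : 𝓓(I, ℝ)) {W : ℝ → ℝ} (hφ : ∀ x, fourierIntegral (fun t => (φ t : ℂ)) x = W x)
    (hWc : Continuous W) (hW0 : ∀ x, 0 ≤ W x) (hWi : Integrable W) {B : ℝ} (hWB : ∀ x, W x ≤ B) :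
    IntegrableOn (fun x => S x * Real.exp (-x) * W x) (Set.Ioi 0) ∧
      |(∫ x in Set.Ioi 0, S x * Real.exp (-x) * W x) - a * ∫ x in Set.Ioi 0, W x| ≤ ‖g φ‖ := by
  set D : ℝ → ℝ := fun x => S x * Real.exp (-x) with hD
  have hDε : ∀ ε > 0, IntegrableOn (fun x => Real.exp (-ε * x) * D x) (Set.Ioi 0) := fun ε hε =>
    integrableOn_exp_mul_of_laplaceConvergesAt hS hx₀ hM hε
      (hconv _ (by rw [Complex.ofReal_re]; linarith))
  have hDloc : IntegrableOn D (Set.Ioc 0 x₀) := by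
    have h1 : IntegrableOn S (Set.Icc 0 x₀) :=
      hS.integrableOn_compact_subset (fun x hx => hx.1) isCompact_Icc
    exact (h1.mul_continuousOn (by fun_prop) isCompact_Icc).mono_set Set.Ioc_subset_Icc_self
  set f : ℝ → ℝ := fun x => (D x - a) * W x with hf
  have hM0 : 0 ≤ |M| := abs_nonneg M
  have hB0 : 0 ≤ B := (hW0 0).trans (hWB 0)
  have hfε : ∀ ε > 0, IntegrableOn (fun x => Real.exp (-ε * x) * f x) (Set.Ioi 0) := by
    intro ε hε
    have h1 : IntegrableOn (fun x => (Real.exp (-ε * x) * D x - Real.exp (-ε * x) * a) * W x)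
        (Set.Ioi 0) := by
      refine Integrable.mul_bdd (c := B)
        ((hDε ε hε).sub ((exp_neg_integrableOn_Ioi 0 hε).mul_const a))
        hWc.aestronglyMeasurable (ae_of_all _ fun x => ?_)
      rw [Real.norm_of_nonneg (hW0 x)]
      exact hWB x
    refine h1.congr (ae_of_all _ fun x => ?_)
    simp only [hf]
    ring
  -- An integrable `b` with `-b ≤ f`: no lower bound for `D` is available on `(0, x₀]`, where local
  -- integrability and `W ≤ B` are used instead.
  set b : ℝ → ℝ := fun x => (Set.Ioc 0 x₀).indicator (fun x => |D x| * B) x + (|M| + a) * W x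
    with hb
  have hind0 : ∀ x, 0 ≤ (Set.Ioc 0 x₀).indicator (fun x => |D x| * B) x :=
    fun x => Set.indicator_nonneg (fun x _ => mul_nonneg (abs_nonneg _) hB0) x
  have hbi : IntegrableOn b (Set.Ioi 0) :=
    ((integrable_indicator_iff measurableSet_Ioc).2 (hDloc.abs.mul_const B)).integrableOn.add
      (hWi.const_mul _).integrableOn
  have hlim : Tendsto (fun ε => ∫ x in Set.Ioi 0, Real.exp (-ε * x) * f x) (𝓝[>] 0)
      (𝓝 (g φ).re) := by
    have h1 : Tendsto (fun ε : ℝ => 1 + ε) (𝓝[>] 0) (𝓝[>] 1) := by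
      refine tendsto_nhdsWithin_iff.2 ⟨?_, ?_⟩
      · have : Tendsto (fun ε : ℝ => 1 + ε) (𝓝 0) (𝓝 (1 + 0)) :=
          (continuous_const.add continuous_id).tendsto 0
        rw [add_zero] at this
        exact this.mono_left nhdsWithin_le_nhds
      · filter_upwards [self_mem_nhdsWithin] with ε hε
        simpa using hε
    refine ((Complex.continuous_re.tendsto _).comp ((hg φ).comp h1)).congr' ?_
    filter_upwards [self_mem_nhdsWithin] with ε hε
    have hε0 : (0 : ℝ) < ε := hε
    have hint := hDε ε hε
    simp only [Function.comp_apply]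
    rw [integral_laplace_sub_mul (σ := 1 + ε) (by linarith) (by simpa using hint) a
      (φ.continuous.integrable_of_hasCompactSupport φ.hasCompactSupport) hφ, Complex.ofReal_re]
    simp [hf, hD]
  obtain ⟨hfi, hfl⟩ := integrableOn_and_setIntegral_eq_of_tendsto_abel hfε hbi
    (fun x _ => add_nonneg (hind0 x) (mul_nonneg (by positivity) (hW0 x))) (fun x hx => by
      have hWx := hW0 x
      simp only [hb, hf]
      by_cases hx1 : x ≤ x₀
      · rw [Set.indicator_of_mem (Set.mem_Ioc.2 ⟨hx, hx1⟩)]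
        have h1 := neg_abs_le (D x)
        have h2 := mul_le_mul_of_nonneg_right h1 hWx
        have h3 : |D x| * W x ≤ |D x| * B := by gcongr; exact hWB x
        have h4 : 0 ≤ |M| * W x := by positivity
        linarith
      · push Not at hx1
        have h1 := hM x hx1.le
        have h2 : -|M| ≤ D x := by linarith [le_abs_self M]
        have h3 := mul_le_mul_of_nonneg_right h2 hWx
        have h4 := hind0 x
        linarith) hlim
  have hDW : IntegrableOn (fun x => D x * W x) (Set.Ioi 0) := by
    refine (hfi.add (hWi.const_mul a).integrableOn).congr (ae_of_all _ fun x => ?_)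
    simp only [hf, Pi.add_apply]
    ring
  refine ⟨hDW, ?_⟩
  have h1 : ∫ x in Set.Ioi 0, f x
      = (∫ x in Set.Ioi 0, D x * W x) - a * ∫ x in Set.Ioi 0, W x := by
    rw [← integral_const_mul, ← integral_sub hDW (hWi.const_mul a).integrableOn]
    congr 1 with x
    simp only [hf]
    ring
  rw [← h1, hfl]
  exact Complex.abs_re_le_norm _

/-- Near the origin, the averages of `S(x) / e^x` against a sufficiently flat kernel are close
to `a`. -/
theorem exists_kernel_average_near {S : ℝ → ℝ}
    (hS : LocallyIntegrableOn S (Set.Ici 0)) {x₀ M : ℝ} (hx₀ : 0 ≤ x₀)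
    (hM : ∀ x, x₀ ≤ x → -M ≤ S x * Real.exp (-x))
    (hconv : ∀ s : ℂ, 1 < s.re → LaplaceConvergesAt S s) {a : ℝ} (ha : 0 < a) {g : 𝓓'(I, ℂ)}
    (hg : IsBoundaryValue (fun s : ℂ => laplace S s - (a : ℂ) / (s - 1)) g)
    {g₁ : ℝ → ℂ} {g₂ g₃ : 𝓓'(I, ℂ)} (hg₁0 : g₁ 0 = 0) (hg₃ : MemPFLoc g₃ 0)
    (hdecomp : IsProductNear 0 g₁ g₂ (g - g₃)) :
    ∃ K : ℝ → ℝ, IsTauberianKernel K ∧ ∀ᶠ h in atTop,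
      IntegrableOn (fun x => S x * Real.exp (-x) * symmTranslate K h x) (Set.Ioi 0) ∧
      |(∫ x in Set.Ioi 0, S x * Real.exp (-x) * symmTranslate K h x) - a * ∫ x, K x|
        ≤ a / 2 * ∫ x, K x := by
  obtain ⟨U, hU, h0U, hUI, u, T, P, ⟨f₁, f₂, hf₁, hf₂, hu, -, hP⟩, hg₁u, -, hgP⟩ := hdecomp
  obtain ⟨V, hV, h0V, hVI, T₃, ⟨f₃, hf₃, hf₃lim, hT₃⟩, hgT₃⟩ := hg₃
  have hmean : ∫ y, f₁ y = 0 := by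
    have h1 : u 0 = 0 := by rw [← hg₁u h0U, hg₁0]
    rw [hu] at h1
    simpa [fourierIntegral] using h1
  obtain ⟨r, hr0, hr⟩ := Metric.isOpen_iff.1 (hU.inter hV) 0 ⟨h0U, h0V⟩
  obtain ⟨φ₀, K₀, hφ₀d, hφ₀c, hφ₀s, hK₀, hφ₀K⟩ := exists_isTauberianKernel
  set m := ∫ x, K₀ x with hm
  have hm0 : 0 < m := hK₀.integral_pos
  -- `L` is fixed before `h`, uniformly in `h`; `L > 1/r` places the support inside both
  -- neighbourhoods. The product and pseudofunction parts each get `a/4 * m` of the allowed `a/2 *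
  -- m`.
  obtain ⟨L, hL, hLr, hL1⟩ := ((hK₀.eventually_norm_integral_convolution_mul_le hf₁ hf₂ hmean
    (ε := a / 4 * m) (by positivity)).and
      ((eventually_gt_atTop (1 / r)).and (eventually_ge_atTop 1))).exists
  have hL0 : 0 < L := by linarith
  set K : ℝ → ℝ := fun x => L⁻¹ * K₀ (x / L) with hKdef
  have hK : IsTauberianKernel K := hK₀.rescale hL1
  have hmK : ∫ x, K x = m := IsTauberianKernel.integral_rescale K₀ hL1
  refine ⟨K, hK, ?_⟩
  rw [hmK]
  filter_upwards [hK.eventually_norm_integral_mul_le hf₃ hf₃lim (ε := a / 4 * m) (by positivity)]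
    with h hh
  have hφLd : ContDiff ℝ ∞ fun t => φ₀ (L * t) := hφ₀d.comp (by fun_prop)
  have hφLc : HasCompactSupport fun t => φ₀ (L * t) :=
    hφ₀c.comp_homeomorph (Homeomorph.mulLeft₀ L hL0.ne')
  have hsupp : tsupport (fun t => 2 * Real.cos (h * t) * φ₀ (L * t)) ⊆ U ∩ V := by
    refine subset_trans (closure_minimal (t := Metric.closedBall 0 (1 / L)) (fun t ht => ?_)
      Metric.isClosed_closedBall) ((Metric.closedBall_subset_ball ?_).trans hr)
    · rw [mem_closedBall_zero_iff, Real.norm_eq_abs, le_div_iff₀ hL0]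
      by_contra! hlt
      refine ht ?_
      change 2 * Real.cos (h * t) * φ₀ (L * t) = 0
      rw [hφ₀s (L * t) (by rw [abs_mul, abs_of_pos hL0]; linarith), mul_zero]
    · rw [div_lt_iff₀ hL0]
      rwa [div_lt_iff₀ hr0, mul_comm] at hLr
  let φ : 𝓓(I, ℝ) :=
    ⟨fun t => 2 * Real.cos (h * t) * φ₀ (L * t),
      ContDiff.mul (contDiff_const.mul (Real.contDiff_cos.comp (by fun_prop))) hφLd,
      hφLc.mul_left, hsupp.trans (Set.inter_subset_left.trans hUI)⟩
  have hφW : ∀ x, fourierIntegral (fun t => (φ t : ℂ)) x = symmTranslate K h x :=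
    fourierIntegral_two_cos_mul (hφLd.continuous.integrable_of_hasCompactSupport hφLc)
      (fun x => fourierIntegral_comp_mul_left hφ₀K hL0 x) h
  obtain ⟨B, hB⟩ := hK.bounded
  obtain ⟨hint, hle⟩ := hg.integrableOn_and_norm_setIntegral_le hS hx₀ hM hconv ha.le φ hφW
    (hK.symmTranslate_continuous h) (hK.symmTranslate_nonneg h) (hK.symmTranslate_integrable h)
    (B := B + B) (fun x => add_le_add (hB _) (hB _))
  rw [hK.setIntegral_symmTranslate, hmK] at hle
  refine ⟨hint, hle.trans ?_⟩
  have hSch : ∀ x, fourierIntegral (toSchwartz φ) x = symmTranslate K h x := hφW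
  have e1 : (g - g₃) φ = ∫ x, (∫ y, f₁ y * f₂ (x - y)) * (symmTranslate K h x : ℂ) := by
    rw [hgP φ (hsupp.trans Set.inter_subset_left), hP]
    simp_rw [hSch]
  have e2 : g₃ φ = ∫ x, f₃ x * (symmTranslate K h x : ℂ) := by
    rw [hgT₃ φ (hsupp.trans Set.inter_subset_right), hT₃]
    simp_rw [hSch]
  have e3 : g φ = (g - g₃) φ + g₃ φ := by
    change g φ = (g φ - g₃ φ) + g₃ φ
    ring
  rw [e3]
  refine (norm_add_le _ _).trans ?_
  rw [e1, e2]
  have := hL h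
  linarith

end BoundaryValue

end WienerIkehara

/-! ### The two-sided bound for `S` -/

theorem theorem3p1 (S : ℝ → ℝ)
    (hS : LocallyIntegrableOn S (Set.Ici 0))
    (hdec : WienerIkehara.StronglyLogLinearlySlowlyDecreasing S)
    (hconv : ∀ s : ℂ, 1 < s.re → WienerIkehara.LaplaceConvergesAt S s)
    (a : ℝ) (ha : 0 < a)
    (I : TopologicalSpace.Opens ℝ) (hI : (I : Set ℝ).OrdConnected)
    (hIb : Bornology.IsBounded (I : Set ℝ)) (h0I : (0 : ℝ) ∈ I)
    (g : 𝓓'(I, ℂ))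
    (hg : WienerIkehara.IsBoundaryValue
      (fun s : ℂ => WienerIkehara.laplace S s - (a : ℂ) / (s - 1)) g)
    (g₁ : ℝ → ℂ) (g₂ g₃ : 𝓓'(I, ℂ))
    (hg₁ : WienerIkehara.MemWienerLoc g₁ 0) (hg₁0 : g₁ 0 = 0)
    (hg₂ : WienerIkehara.MemPMLoc g₂ 0)
    (hg₃ : WienerIkehara.MemPFLoc g₃ 0)
    (hdecomp : WienerIkehara.IsProductNear 0 g₁ g₂ (g - g₃)) :
    (Real.exp =O[atTop] S ∧ S =O[atTop] Real.exp) ∧ ∀ᶠ x : ℝ in atTop, 0 < S x := by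
  obtain ⟨η, x₀, hx₀, hη, hanti, hηlim, hD⟩ := hdec.exists_antitone
  set D : ℝ → ℝ := fun x => S x * Real.exp (-x) with hDdef
  have hloc : ∀ b, IntegrableOn D (Set.Ioc 0 b) := by
    intro b
    have h1 : IntegrableOn S (Set.Icc 0 b) :=
      hS.integrableOn_compact_subset (fun x hx => hx.1) isCompact_Icc
    exact (h1.mul_continuousOn (by fun_prop) isCompact_Icc).mono_set Set.Ioc_subset_Icc_self
  have hlow : ∀ x, x₀ ≤ x → -(|D x₀| + η x₀) ≤ D x := fun x hx =>
    WienerIkehara.neg_le_of_slowlyDecreasing hD hx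
  obtain ⟨K, hK, hKD⟩ := WienerIkehara.exists_kernel_average_near hS hx₀.le hlow hconv ha hg hg₁0
    hg₃ hdecomp
  have hm : 0 < ∫ x, K x := hK.integral_pos
  -- An error of at most `a/2 * ∫ K` around `a * ∫ K` leaves the averages between `a/2 * ∫ K` and
  -- `3/2 * a * ∫ K`.
  obtain ⟨M, hM⟩ := hK.exists_eventually_le hx₀ hη hanti hD (hloc x₀)
    (B := 3 / 2 * a * ∫ x, K x) (hKD.mono fun h hh => ⟨hh.1, by
      have := (abs_le.1 hh.2).2
      linarith⟩)
  obtain ⟨c, hc, hcD⟩ := hK.exists_pos_eventually_le hx₀ hηlim hanti hD hloc hM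
    (β := a / 2 * ∫ x, K x) (by positivity) (hKD.mono fun h hh => ⟨hh.1, by
      have := (abs_le.1 hh.2).1
      linarith⟩)
  have hSD : ∀ x, S x = D x * Real.exp x := fun x => by
    rw [hDdef]
    simp only
    rw [mul_assoc, ← Real.exp_add]
    simp
  have hpos : ∀ᶠ x in atTop, 0 < S x := by
    filter_upwards [hcD] with x hx
    rw [hSD]
    exact mul_pos (hc.trans_le hx) (Real.exp_pos x)
  refine ⟨⟨Asymptotics.IsBigO.of_bound c⁻¹ ?_, Asymptotics.IsBigO.of_bound M ?_⟩, hpos⟩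
  · filter_upwards [hcD, hpos] with x hx hx0
    rw [Real.norm_of_nonneg (Real.exp_pos x).le, Real.norm_of_nonneg hx0.le,
      ← div_eq_inv_mul, le_div_iff₀ hc, hSD, mul_comm]
    exact mul_le_mul_of_nonneg_right hx (Real.exp_pos x).le
  · filter_upwards [hM, hpos] with x hx hx0
    rw [Real.norm_of_nonneg (Real.exp_pos x).le, Real.norm_of_nonneg hx0.le, hSD]
    exact mul_le_mul_of_nonneg_right hx (Real.exp_pos x).le
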